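/- **Model.** Let $k\ge 0$, $r\ge 1$, $\pi_0\in(0,1)$, $\theta\in\mathbb R^k$, $\beta^0\in\mathbb R^r$, and let $(N,T)\to\infty$ along a path of sample sizes. All random variables live on one probability space and may form triangular arrays along the path. Let $k_0=\lfloor T\pi_0\rfloor$ and $$x_t=\Lambda f_t+e_t\in\mathbb R^N,\qquad y_{t+1}=\theta'w_t+\beta'f_t+u_{t+1},\qquad \beta=T^{-1/4}\beta^0,\qquad z_t=(w_t',f_t')'\in\mathbb R^{k+r},$$ where $\Lambda=(\lambda_1,\dots,\lambda_N)'$ is the random $N\times r$ loading matrix. Let $X_t,F_t,E_t$ be the matrices with rows $x_s',f_s',e_s'$, $s=1,\dots,t$. Let $\|\cdot\|$ be the Euclidean/Frobenius norm and $\|\cdot\|_{sp}$ the spectral norm. **Estimators.** For $k_0\le t\le T-1$ let $\widehat F_t=\sqrt t\,U_t$, where the columns of $U_t$ are any orthonormal eigenvectors of $(Nt)^{-1}X_tX_t'$ for its $r$ largest eigenvalues. Let $D_{Nt,r}^2$ be the diagonal matrix of these eigenvalues in decreasing order, $H_{Nt,r}=D_{Nt,r}^{-2}(t^{-1}\widehat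 F_t'F_t)(N^{-1}\Lambda'\Lambda)$ and $\Phi_{Nt,r}=\mathrm{diag}(I_k,H_{Nt,r})$. Put $\widehat z_s=(w_s',\widehat f_s')'$ with $\widehat f_s'$ the $s$-th row of $\widehat F_t$, and $$\widetilde\delta_t=\Big(\sum_{s=1}^{t-1}z_sz_s'\Big)^{-1}\sum_{s=1}^{t-1}z_sy_{s+1},\qquad \widehat\delta_t=\Big(\sum_{s=1}^{t-1}\widehat z_s\widehat z_s'\Big)^{-1}\sum_{s=1}^{t-1}\widehat z_sy_{s+1}.$$ **Assumptions.** For some constant $M$ not depending on $t,i,N,T$: 1. $E(u_{t+1}\mid\mathcal F_t)=0$ for $1\le t<T$, with $\mathcal F_t=\sigma(z_s,x_s,y_s:1\le s\le t)$; $E(u_{t+1}^4)\le M$; and the process $(u_t)_{2\le t\le T}$ is independent of $(\Lambda,(f_t)_{1\le t\le T},(e_t)_{1\le t\le T})$. 2. $E\|z_t\|^8\le M$ for $1\le t\le T$; $E(z_tz_t')=\Sigma_z$ is positive definite with lower right $r\times r$ block $I_r$; and $\sup_{k_0\le t\le T-1}\big\|\frac1T\sum_{s=1}^t(z_sz_s'-\Sigma_z)\big\|=O_p(T^{-1/2})$.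 3. $E(e_{i,t}^4)\le M$ for $1\le i\le N$, $1\le t\le T$, and $\sup_{k_0\le t\le T-1}\|E_t\|_{sp}=O_p(\max\{\sqrt N,\sqrt T\})$. **Claim (i), homogeneously weak loadings.** Let $\alpha\in(1/2,1]$ and $N^{1-\alpha}T^{-1/2}\to0$. Suppose that $\|N^{-\alpha}\Lambda'\Lambda-\Sigma_\Lambda\|=O_p(N^{-\alpha/2})$ with $\Sigma_\Lambda$ positive definite, and that $E\|N^{-\alpha/2}\sum_{i=1}^N\lambda_ie_{i,t}\|^8\le M$ for $1\le t\le T$. Then $$\sup_{k_0\le t\le T-1}\big\|T^{1/4}\big(\widehat\delta_t-(\Phi_{Nt,r}^{-1})'\widetilde\delta_t\big)\big\|=o_p(1),$$ $$\sup_{k_0\le t\le T-1}\big\|T^{1/4}\big(\widehat\delta_t-(\Phi_{Nt,r}^{-1})'\widetilde\delta_t\big)\big\|^2=O_p\Big(\frac{N^{2-2\alpha}}{k_0}\Big)+O_p(N^{1-2\alpha})+O_p(T^{-1/2}).$$ **Claim (ii), heterogeneously weak loadings.** Let $1\ge\alpha_1\ge\dots\ge\alpha_r>1/2$, $B_N=\mathrm{diag}(N^{\alpha_1/2},\dots,N^{\alpha_r/2})$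 and $N^{1-\alpha_r}T^{-1/2}\to0$. Suppose that $\|B_N^{-1}\Lambda'\Lambda B_N^{-1}-\Sigma_\Lambda\|=O_p(N^{-\alpha_r/2})$ with $\Sigma_\Lambda$ positive definite, and that $E\|B_N^{-1}\sum_{i=1}^N\lambda_ie_{i,t}\|^8\le M$ for $1\le t\le T$. Then both conclusions of (i) hold with $\alpha_r$ in place of $\alpha$. -/

import Mathlib

open MeasureTheory ProbabilityTheory Filter Topology Matrix

namespace FactorForecast

noncomputable section

/-! ### Norms, suprema and stochastic orders -/

/-- Euclidean norm `√(v'v)` of a real vector. -/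
def vnorm {ι : Type*} [Fintype ι] (v : ι → ℝ) : ℝ := Real.sqrt (v ⬝ᵥ v)

/-- Frobenius norm `√(tr (A'A))` of a real matrix. -/
def frob {m n : Type*} [Fintype m] [Fintype n] (A : Matrix m n ℝ) : ℝ :=
  Real.sqrt (Aᵀ * A).trace

/-- Spectral norm of a real matrix: the operator norm between Euclidean spaces. -/
def spNorm {m n : Type*} [Fintype m] [Fintype n] [DecidableEq n] (A : Matrix m n ℝ) : ℝ :=
  ‖(Matrix.toEuclideanLin A).toContinuousLinearMap‖

/-- `sup_{a ≤ t ≤ b} g t` over the integers `a, …, b`. -/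
def supIcc (a b : ℕ) (g : ℕ → ℝ) : ℝ := ⨆ t : Set.Icc a b, g t

/-- `X n = O_p(c n)` as `n → ∞`. For nonnegative sequences,
`O_p(a) + O_p(b)` is the same as `O_p(a + b)`. -/
def IsBigOp {Ω : Type*} [MeasurableSpace Ω] (P : Measure Ω) (X : ℕ → Ω → ℝ) (c : ℕ → ℝ) : Prop :=
  ∀ ε : ℝ, 0 < ε → ∃ C : ℝ, 0 < C ∧
    ∀ᶠ n in atTop, P {ω | C * c n < |X n ω|} ≤ ENNReal.ofReal ε

/-- `X n = o_p(1)` as `n → ∞`, i.e. convergence to `0` in probability. -/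
def IsLittleOpOne {Ω : Type*} [MeasurableSpace Ω] (P : Measure Ω) (X : ℕ → Ω → ℝ) : Prop :=
  TendstoInMeasure P X atTop (fun _ => (0 : ℝ))

/-- `E |X| ^ p` exists and is at most `M`. -/
def MomentLE {Ω : Type*} [MeasurableSpace Ω] (P : Measure Ω) (X : Ω → ℝ) (p : ℕ) (M : ℝ) : Prop :=
  Integrable (fun ω => |X ω| ^ p) P ∧ ∫ ω, |X ω| ^ p ∂P ≤ M

/-! ### Principal components -/

/-- `(N t)⁻¹ X X'` for a `t × N` data matrix `X`. -/
def scaledGram {t N : ℕ} (X : Matrix (Fin t) (Fin N) ℝ) : Matrix (Fin t) (Fin t) ℝ :=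
  ((N : ℝ) * (t : ℝ))⁻¹ • (X * Xᵀ)

theorem scaledGram_isHermitian {t N : ℕ} (X : Matrix (Fin t) (Fin N) ℝ) :
    (scaledGram X).IsHermitian := by
  unfold scaledGram
  rw [Matrix.IsHermitian, Matrix.conjTranspose_smul]
  simp [Matrix.conjTranspose_eq_transpose_of_trivial, Matrix.transpose_mul]

/-- The `j`-th largest eigenvalue (`j = 0` being the largest, with multiplicity) of
`(N t)⁻¹ X X'`; it is `0` if the matrix has at most `j` eigenvalues. -/
def pcEigenvalue {t N : ℕ} (X : Matrix (Fin t) (Fin N) ℝ) (j : ℕ) : ℝ :=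
  if h : j < Fintype.card (Fin t) then (scaledGram_isHermitian X).eigenvalues₀ ⟨j, h⟩ else 0

/-- The diagonal matrix `D²` of the `r` largest eigenvalues of `(N t)⁻¹ X X'`, in decreasing
order. -/
def pcDsq {t N : ℕ} (r : ℕ) (X : Matrix (Fin t) (Fin N) ℝ) : Matrix (Fin r) (Fin r) ℝ :=
  Matrix.diagonal (fun j => pcEigenvalue X j)

/-- `Fh = √t U`, where the columns of `U` are orthonormal eigenvectors of `(N t)⁻¹ X X'` for its
`r` largest eigenvalues. -/
def IsPCFactors {t N r : ℕ} (X : Matrix (Fin t) (Fin N) ℝ) (Fh : Matrix (Fin t) (Fin r) ℝ) :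
    Prop :=
  Fhᵀ * Fh = (t : ℝ) • (1 : Matrix (Fin r) (Fin r) ℝ) ∧ scaledGram X * Fh = Fh * pcDsq r X

/-- The rotation matrix `H = D⁻² (t⁻¹ Fh' F) (N⁻¹ Λ'Λ)`. -/
def rotation {t N r : ℕ} (X : Matrix (Fin t) (Fin N) ℝ) (Fh F : Matrix (Fin t) (Fin r) ℝ)
    (L : Matrix (Fin N) (Fin r) ℝ) : Matrix (Fin r) (Fin r) ℝ :=
  (pcDsq r X)⁻¹ * ((t : ℝ)⁻¹ • (Fhᵀ * F)) * ((N : ℝ)⁻¹ • (Lᵀ * L))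

/-- Least squares coefficient `(∑ z_s z_s')⁻¹ ∑ z_s y_s` over `m` observations. -/
def ols {m : ℕ} {ι : Type*} [Fintype ι] [DecidableEq ι] (z : Fin m → ι → ℝ) (y : Fin m → ℝ) :
    ι → ℝ :=
  (∑ s, Matrix.vecMulVec (z s) (z s))⁻¹ *ᵥ (∑ s, y s • z s)

/-! ### The data -/

/-- The random quantities of the model, along a path `(N n, T n)` of sample sizes; `k` known
predictors, `r` factors. Time runs over `1, 2, …`. All quantities may form triangular arrays. -/
structure Panel (Ω : Type*) (k r : ℕ) where
  /-- number of series -/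
  N : ℕ → ℕ
  /-- number of periods -/
  T : ℕ → ℕ
  /-- loadings `Λ`, with rows `λ_i'` -/
  lam : (n : ℕ) → Ω → Matrix (Fin (N n)) (Fin r) ℝ
  /-- factors `f_t` -/
  f : ℕ → ℕ → Ω → Fin r → ℝ
  /-- known predictors `w_t` -/
  w : ℕ → ℕ → Ω → Fin k → ℝ
  /-- idiosyncratic components `e_t = (e_{1,t}, …, e_{N,t})'` -/
  e : (n : ℕ) → ℕ → Ω → Fin (N n) → ℝ
  /-- forecast errors `u_t` -/
  u : ℕ → ℕ → Ω → ℝ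
  /-- target `y_t` -/
  y : ℕ → ℕ → Ω → ℝ

namespace Panel

variable {Ω : Type*} {k r : ℕ} (D : Panel Ω k r)

/-- `z_t = (w_t', f_t')'`. -/
def z (n t : ℕ) (ω : Ω) : Fin k ⊕ Fin r → ℝ := Sum.elim (D.w n t ω) (D.f n t ω)

/-- `x_t = Λ f_t + e_t`. -/
def x (n t : ℕ) (ω : Ω) : Fin (D.N n) → ℝ := D.lam n ω *ᵥ D.f n t ω + D.e n t ω

/-- `X_t`, with rows `x_1', …, x_t'`. -/
def X (n t : ℕ) (ω : Ω) : Matrix (Fin t) (Fin (D.N n)) ℝ :=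
  Matrix.of fun s i => D.x n (s + 1) ω i

/-- `F_t`, with rows `f_1', …, f_t'`. -/
def F (n t : ℕ) (ω : Ω) : Matrix (Fin t) (Fin r) ℝ :=
  Matrix.of fun s j => D.f n (s + 1) ω j

/-- `E_t`, with rows `e_1', …, e_t'`. -/
def E (n t : ℕ) (ω : Ω) : Matrix (Fin t) (Fin (D.N n)) ℝ :=
  Matrix.of fun s i => D.e n (s + 1) ω i

/-- Length `k₀ = ⌊T π₀⌋` of the initial estimation window. -/
def k0 (π₀ : ℝ) (n : ℕ) : ℕ := ⌊(D.T n : ℝ) * π₀⌋₊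

/-- The information `σ(z_s, x_s, y_s : 1 ≤ s ≤ t)` available at time `t`. -/
@[reducible] def info (n t : ℕ) : MeasurableSpace Ω :=
  ⨆ s : Set.Icc 1 t,
    MeasurableSpace.comap (D.z n s) inferInstance ⊔
      MeasurableSpace.comap (D.x n s) inferInstance ⊔
      MeasurableSpace.comap (D.y n s) inferInstance

/-- Infeasible estimator `δ̃_t = (∑_{s=1}^{t-1} z_s z_s')⁻¹ ∑_{s=1}^{t-1} z_s y_{s+1}`. -/
def deltaTilde (n t : ℕ) (ω : Ω) : Fin k ⊕ Fin r → ℝ :=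
  ols (m := t - 1) (fun s => D.z n (s + 1) ω) (fun s => D.y n (s + 2) ω)

/-- Feasible estimator `δ̂_t = (∑_{s=1}^{t-1} ẑ_s ẑ_s')⁻¹ ∑_{s=1}^{t-1} ẑ_s y_{s+1}`, where
`ẑ_s = (w_s', f̂_s')'` and `f̂_s'` is the `s`-th row of the factor estimate `Fh`, which is
computed from the data `X_t` up to time `t`. -/
def deltaHat (n t : ℕ) (Fh : Matrix (Fin t) (Fin r) ℝ) (ω : Ω) : Fin k ⊕ Fin r → ℝ :=
  ols (m := t - 1)
    (fun s => Sum.elim (D.w n (s + 1) ω) (Fh (Fin.castLE (Nat.sub_le t 1) s)))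
    (fun s => D.y n (s + 2) ω)

/-- `Φ = diag(I_k, H)`. -/
def Phi (n t : ℕ) (Fh : Matrix (Fin t) (Fin r) ℝ) (ω : Ω) :
    Matrix (Fin k ⊕ Fin r) (Fin k ⊕ Fin r) ℝ :=
  Matrix.fromBlocks 1 0 0 (rotation (D.X n t ω) Fh (D.F n t ω) (D.lam n ω))

/-- `sup_{k₀ ≤ t ≤ T-1} ‖T^{1/4} (δ̂_t - (Φ⁻¹)' δ̃_t)‖`. -/
def supGap (π₀ : ℝ) (Fh : (n t : ℕ) → Ω → Matrix (Fin t) (Fin r) ℝ) (n : ℕ) (ω : Ω) : ℝ :=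
  supIcc (D.k0 π₀ n) (D.T n - 1) fun t =>
    vnorm (((D.T n : ℝ) ^ (1 / 4 : ℝ)) •
      (D.deltaHat n t (Fh n t ω) ω - ((D.Phi n t (Fh n t ω) ω)⁻¹)ᵀ *ᵥ D.deltaTilde n t ω))

/-- `N^{2-2α} / k₀ + N^{1-2α} + T^{-1/2}`. -/
def gapRate (π₀ α : ℝ) (n : ℕ) : ℝ :=
  (D.N n : ℝ) ^ (2 - 2 * α) / (D.k0 π₀ n : ℝ) + (D.N n : ℝ) ^ (1 - 2 * α)
    + (D.T n : ℝ) ^ (-(1 / 2) : ℝ)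

/-- The feasible estimator is uniformly close to the rotated infeasible one, with strength
index `α`. -/
def UniformlyClose [MeasurableSpace Ω] (P : Measure Ω) (π₀ α : ℝ)
    (Fh : (n t : ℕ) → Ω → Matrix (Fin t) (Fin r) ℝ) : Prop :=
  IsLittleOpOne P (D.supGap π₀ Fh) ∧
    IsBigOp P (fun n ω => D.supGap π₀ Fh n ω ^ 2) (D.gapRate π₀ α)

/-- All primitives are random variables. -/
structure IsMeasurable [MeasurableSpace Ω] : Prop where
  lam : ∀ n i j, Measurable fun ω => D.lam n ω i j
  f : ∀ n t, Measurable (D.f n t)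
  w : ∀ n t, Measurable (D.w n t)
  e : ∀ n t, Measurable (D.e n t)
  u : ∀ n t, Measurable (D.u n t)
  y : ∀ n t, Measurable (D.y n t)

/-- The forecasting model `y_{t+1} = θ'w_t + β'f_t + u_{t+1}` with `β = T^{-1/4} β⁰`. -/
def IsModel (θ : Fin k → ℝ) (β0 : Fin r → ℝ) : Prop :=
  ∀ n t, 1 ≤ t → t < D.T n → ∀ ω,
    D.y n (t + 1) ω = θ ⬝ᵥ D.w n t ω
      + (((D.T n : ℝ) ^ (-(1 / 4) : ℝ)) • β0) ⬝ᵥ D.f n t ω + D.u n (t + 1) ω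

/-- Conditions on the forecast errors. -/
structure ForecastError [MeasurableSpace Ω] (P : Measure Ω) : Prop where
  /-- martingale difference sequence -/
  mds : ∀ n t, 1 ≤ t → t < D.T n →
    Integrable (D.u n (t + 1)) P ∧ P[D.u n (t + 1)|D.info n t] =ᵐ[P] 0
  /-- uniformly bounded fourth moments -/
  moment : ∃ M : ℝ, ∀ n t, 1 ≤ t → t < D.T n → MomentLE P (D.u n (t + 1)) 4 M
  /-- the errors are independent of loadings, factors and idiosyncratic components -/
  indep : ∀ n, IndepFun
    (fun ω (t : Set.Icc 2 (D.T n)) => D.u n t ω)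
    (fun ω => ((fun i j => D.lam n ω i j : Fin (D.N n) → Fin r → ℝ),
      (fun t : Set.Icc 1 (D.T n) => D.f n t ω), (fun t : Set.Icc 1 (D.T n) => D.e n t ω))) P

/-- Conditions on factors and predictors. -/
structure Predictors [MeasurableSpace Ω] (P : Measure Ω) (π₀ : ℝ)
    (Sz : Matrix (Fin k ⊕ Fin r) (Fin k ⊕ Fin r) ℝ) : Prop where
  /-- uniformly bounded eighth moments -/
  moment : ∃ M : ℝ, ∀ n t, 1 ≤ t → t ≤ D.T n → MomentLE P (fun ω => vnorm (D.z n t ω)) 8 M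
  /-- `Σ_z = E(z_t z_t')` -/
  second : ∀ n t, 1 ≤ t → t ≤ D.T n → ∀ a b, ∫ ω, D.z n t ω a * D.z n t ω b ∂P = Sz a b
  /-- the factor block of `Σ_z` is the identity -/
  block : Sz.toBlocks₂₂ = 1
  posDef : Sz.PosDef
  /-- uniform law of large numbers with rate -/
  lln : IsBigOp P
    (fun n ω => supIcc (D.k0 π₀ n) (D.T n - 1) fun t =>
      frob ((D.T n : ℝ)⁻¹ • ∑ s ∈ Finset.Icc 1 t,
        (Matrix.vecMulVec (D.z n s ω) (D.z n s ω) - Sz)))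
    (fun n => (D.T n : ℝ) ^ (-(1 / 2) : ℝ))

/-- Conditions on the idiosyncratic components. -/
structure Idiosyncratics [MeasurableSpace Ω] (P : Measure Ω) (π₀ : ℝ) : Prop where
  /-- uniformly bounded fourth moments -/
  moment : ∃ M : ℝ, ∀ n t, 1 ≤ t → t ≤ D.T n → ∀ i, MomentLE P (fun ω => D.e n t ω i) 4 M
  /-- spectral norm of `E_t` -/
  spectral : IsBigOp P
    (fun n ω => supIcc (D.k0 π₀ n) (D.T n - 1) fun t => spNorm (D.E n t ω))
    (fun n => max (Real.sqrt (D.N n)) (Real.sqrt (D.T n)))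

/-- Homogeneously weak loadings of strength `α`. -/
structure HomLoadings [MeasurableSpace Ω] (P : Measure Ω) (α : ℝ)
    (SL : Matrix (Fin r) (Fin r) ℝ) : Prop where
  posDef : SL.PosDef
  /-- `‖N^{-α} Λ'Λ - Σ_Λ‖ = O_p(N^{-α/2})` -/
  limit : IsBigOp P
    (fun n ω => frob (((D.N n : ℝ) ^ (-α)) • ((D.lam n ω)ᵀ * D.lam n ω) - SL))
    (fun n => (D.N n : ℝ) ^ (-(α / 2)))
  /-- `E ‖N^{-α/2} ∑_i λ_i e_{i,t}‖⁸ ≤ M` -/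
  moment : ∃ M : ℝ, ∀ n t, 1 ≤ t → t ≤ D.T n →
    MomentLE P
      (fun ω => vnorm (((D.N n : ℝ) ^ (-(α / 2))) • ((D.lam n ω)ᵀ *ᵥ D.e n t ω))) 8 M

/-- `B_N⁻¹ = diag(N^{-α_1/2}, …, N^{-α_r/2})`. -/
def Binv (a : Fin r → ℝ) (n : ℕ) : Matrix (Fin r) (Fin r) ℝ :=
  Matrix.diagonal fun j => (D.N n : ℝ) ^ (-(a j / 2))

/-- Heterogeneously weak loadings of strengths `α_1, …, α_r`, with smallest strength `αmin`. -/
structure HetLoadings [MeasurableSpace Ω] (P : Measure Ω) (a : Fin r → ℝ) (αmin : ℝ)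
    (SL : Matrix (Fin r) (Fin r) ℝ) : Prop where
  posDef : SL.PosDef
  /-- `‖B_N⁻¹ Λ'Λ B_N⁻¹ - Σ_Λ‖ = O_p(N^{-α_r/2})` -/
  limit : IsBigOp P
    (fun n ω => frob (D.Binv a n * ((D.lam n ω)ᵀ * D.lam n ω) * D.Binv a n - SL))
    (fun n => (D.N n : ℝ) ^ (-(αmin / 2)))
  /-- `E ‖B_N⁻¹ ∑_i λ_i e_{i,t}‖⁸ ≤ M` -/
  moment : ∃ M : ℝ, ∀ n t, 1 ≤ t → t ≤ D.T n →
    MomentLE P (fun ω => vnorm (D.Binv a n *ᵥ ((D.lam n ω)ᵀ *ᵥ D.e n t ω))) 8 M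

/-- `(N, T) → ∞` with `N^{1-α} T^{-1/2} → 0`. -/
structure Expansion (α : ℝ) : Prop where
  N : Tendsto D.N atTop atTop
  T : Tendsto D.T atTop atTop
  rate : Tendsto (fun n => (D.N n : ℝ) ^ (1 - α) / Real.sqrt (D.T n)) atTop (𝓝 0)

end Panel

end

end FactorForecast

/-! Write `G = Fh - F Hᵀ`. The eigenvalue equation gives exactly `G = (N t)⁻¹ (F (EΛ)ᵀ Fh + EΛ Fᵀ Fh
+ E Eᵀ Fh) D⁻²` (`pcFactors_sub_eq`). Put `T = Q⁴`, `N = a²`, `b² = N^α` with `α` the weakest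
strength. With probability near one, up to constants, `F` and `Fh` have operator norm at most `Q²`,
`E` at most `a + Q²`, `EΛ` at most `a Q²`, and the eigenvalues in `D²` are at least `b² / N`. Hence
`‖G‖ ≲ Q² ρ` with `ρ = a/b² + a²/(b² Q²) = N^{1/2-α} + N^{1-α} T^{-1/2} → 0`. Since `Fh` has
orthogonal columns of length `√t`, a small `G` also keeps `H` away from singularity, so no limit of
`H` is needed.

The normal equations (`vnorm_ols_sub_le`) bound `Ẑ'Ẑ (δ̂ - (Φ⁻¹)'δ̃)` by `G'u`, `G'Z(δ̃ - δ)` and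
`Ẑ'G` applied to the factor block of `(Φ⁻¹)'δ̃`. The score sums `∑ z_s u_{s+1}` are uniformly of
order at most `T^{3/4} = Q³`, so `δ̃ - δ` is of order at most `T^{-1/4}`, the size of `β`. Each of
the three terms is then at most of order `Q³ ρ`, while `Ẑ'Ẑ` is at least of order `Q⁴`; after
multiplication by `T^{1/4} = Q` the gap is of order `ρ`.

Because `β` is of order `T^{-1/4}`, the rate `T^{3/4}` for the maxima of the score sums is enough.
It follows from orthogonality of the summands alone (`exists_isBigOp_partialSum`). This matters
since `Λ` and `e_s` are not observed: the terms `e_s u_{s+1}` are orthogonal by independence,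
without being adapted to the filtration.

The probabilistic input is eight stochastic bounds, imposed at once with one constant
(`exists_forall_isBigOp`). On that event the argument is deterministic at every date
(`vnorm_gap_le`, `gap_le`). Homogeneous loadings are the case of equal exponents. -/

namespace FactorForecast

/-! ### Euclidean, Frobenius and operator norm inequalities. -/

section Euclidean

variable {ι κ μ : Type*} [Fintype ι] [Fintype κ] [Fintype μ]

theorem vnorm_eq_norm (v : ι → ℝ) : vnorm v = ‖WithLp.toLp 2 v‖ := by
  rw [vnorm, EuclideanSpace.norm_eq]
  congr 1
  simp [dotProduct, sq]

theorem vnorm_nonneg (v : ι → ℝ) : 0 ≤ vnorm v := Real.sqrt_nonneg _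

theorem vnorm_sq (v : ι → ℝ) : vnorm v ^ 2 = v ⬝ᵥ v := by
  rw [vnorm, Real.sq_sqrt]
  exact Finset.sum_nonneg fun i _ => mul_self_nonneg _

theorem vnorm_sq_eq_sum (v : ι → ℝ) : vnorm v ^ 2 = ∑ i, v i ^ 2 := by
  rw [vnorm_sq]; simp [dotProduct, sq]

@[simp] theorem vnorm_zero : vnorm (0 : ι → ℝ) = 0 := by simp [vnorm]

theorem vnorm_eq_zero {v : ι → ℝ} (h : vnorm v = 0) : v = 0 := by
  rw [vnorm_eq_norm, norm_eq_zero] at h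
  simpa using h

theorem vnorm_add_le (v w : ι → ℝ) : vnorm (v + w) ≤ vnorm v + vnorm w := by
  simp only [vnorm_eq_norm, WithLp.toLp_add]; exact norm_add_le _ _

theorem vnorm_sub_le (v w : ι → ℝ) : vnorm (v - w) ≤ vnorm v + vnorm w := by
  simp only [vnorm_eq_norm, WithLp.toLp_sub]; exact norm_sub_le _ _

theorem vnorm_smul (c : ℝ) (v : ι → ℝ) : vnorm (c • v) = |c| * vnorm v := by
  simp only [vnorm_eq_norm, WithLp.toLp_smul, norm_smul, Real.norm_eq_abs]

theorem abs_dotProduct_le (v w : ι → ℝ) : |v ⬝ᵥ w| ≤ vnorm v * vnorm w := by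
  have h := abs_real_inner_le_norm (WithLp.toLp 2 w) (WithLp.toLp 2 v)
  rw [← vnorm_eq_norm, ← vnorm_eq_norm] at h
  rw [mul_comm]
  have h' : inner ℝ (WithLp.toLp 2 w) (WithLp.toLp 2 v) = v ⬝ᵥ w := rfl
  rwa [h'] at h

theorem dotProduct_le_vnorm (v w : ι → ℝ) : v ⬝ᵥ w ≤ vnorm v * vnorm w :=
  (le_abs_self _).trans (abs_dotProduct_le v w)

theorem abs_apply_le_vnorm (v : ι → ℝ) (i : ι) : |v i| ≤ vnorm v := by
  apply abs_le_of_sq_le_sq _ (vnorm_nonneg v)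
  rw [vnorm_sq_eq_sum]
  exact Finset.single_le_sum (f := fun i => v i ^ 2) (fun i _ => sq_nonneg _) (Finset.mem_univ i)

theorem vnorm_sumElim_sq (v : ι → ℝ) (w : κ → ℝ) :
    vnorm (Sum.elim v w) ^ 2 = vnorm v ^ 2 + vnorm w ^ 2 := by
  simp [vnorm_sq_eq_sum]

theorem vnorm_inr_le (v : ι ⊕ κ → ℝ) : vnorm (fun j => v (Sum.inr j)) ≤ vnorm v := by
  apply le_of_sq_le_sq _ (vnorm_nonneg _)
  simp only [vnorm_sq_eq_sum, Fintype.sum_sum_type]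
  exact le_add_of_nonneg_left (Finset.sum_nonneg fun i _ => sq_nonneg _)

theorem vnorm_inl_le (v : ι ⊕ κ → ℝ) : vnorm (fun j => v (Sum.inl j)) ≤ vnorm v := by
  apply le_of_sq_le_sq _ (vnorm_nonneg _)
  simp only [vnorm_sq_eq_sum, Fintype.sum_sum_type]
  exact le_add_of_nonneg_right (Finset.sum_nonneg fun i _ => sq_nonneg _)

theorem dotProduct_mulVec_self (A : Matrix ι κ ℝ) (v : κ → ℝ) :
    v ⬝ᵥ (Aᵀ * A) *ᵥ v = vnorm (A *ᵥ v) ^ 2 := by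
  rw [vnorm_sq, ← mulVec_mulVec, dotProduct_mulVec, vecMul_transpose]

/-- `C` bounds the operator norm of `A`. -/
def OpLE (A : Matrix ι κ ℝ) (C : ℝ) : Prop := ∀ v, vnorm (A *ᵥ v) ≤ C * vnorm v

theorem OpLE.mono {A : Matrix ι κ ℝ} {C C' : ℝ} (h : OpLE A C) (hC : C ≤ C') : OpLE A C' :=
  fun v => (h v).trans (mul_le_mul_of_nonneg_right hC (vnorm_nonneg v))

theorem OpLE.add {A B : Matrix ι κ ℝ} {a b : ℝ} (hA : OpLE A a) (hB : OpLE B b) :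
    OpLE (A + B) (a + b) := fun v => by
  rw [add_mulVec, add_mul]
  exact (vnorm_add_le _ _).trans (add_le_add (hA v) (hB v))

theorem OpLE.mul {A : Matrix ι κ ℝ} {B : Matrix κ μ ℝ} {a b : ℝ} (ha : 0 ≤ a)
    (hA : OpLE A a) (hB : OpLE B b) : OpLE (A * B) (a * b) := fun v => by
  rw [← mulVec_mulVec, mul_assoc]
  exact (hA _).trans (mul_le_mul_of_nonneg_left (hB v) ha)

theorem OpLE.smul {A : Matrix ι κ ℝ} {a : ℝ} (hA : OpLE A a) (c : ℝ) :
    OpLE (c • A) (|c| * a) := fun v => by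
  rw [smul_mulVec, vnorm_smul, mul_assoc]
  exact mul_le_mul_of_nonneg_left (hA v) (abs_nonneg c)

/-- Duality: `‖Aᵀv‖² = v · A Aᵀ v ≤ ‖v‖ a ‖Aᵀv‖`, and one factor cancels. -/
theorem OpLE.transpose {A : Matrix ι κ ℝ} {a : ℝ} (ha : 0 ≤ a) (hA : OpLE A a) :
    OpLE Aᵀ a := fun v => by
  rcases (vnorm_nonneg (Aᵀ *ᵥ v)).eq_or_lt with h | h
  · rw [← h]; exact mul_nonneg ha (vnorm_nonneg v)
  · refine le_of_mul_le_mul_right ?_ h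
    calc vnorm (Aᵀ *ᵥ v) * vnorm (Aᵀ *ᵥ v) = v ⬝ᵥ (A *ᵥ (Aᵀ *ᵥ v)) := by
          rw [← sq, vnorm_sq, dotProduct_mulVec v, ← mulVec_transpose]
      _ ≤ vnorm v * vnorm (A *ᵥ (Aᵀ *ᵥ v)) := dotProduct_le_vnorm _ _
      _ ≤ vnorm v * (a * vnorm (Aᵀ *ᵥ v)) :=
          mul_le_mul_of_nonneg_left (hA _) (vnorm_nonneg v)
      _ = a * vnorm v * vnorm (Aᵀ *ᵥ v) := by ring

theorem OpLE.spNorm [DecidableEq κ] (A : Matrix ι κ ℝ) : OpLE A (spNorm A) := fun v => by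
  have h := (Matrix.toEuclideanLin A).toContinuousLinearMap.le_opNorm (WithLp.toLp 2 v)
  rw [vnorm_eq_norm, vnorm_eq_norm]
  exact h

theorem frob_sq (A : Matrix ι κ ℝ) : frob A ^ 2 = ∑ i, ∑ j, A i j ^ 2 := by
  have : (Aᵀ * A).trace = ∑ i, ∑ j, A i j ^ 2 := by
    rw [Finset.sum_comm]
    simp [Matrix.trace, Matrix.mul_apply, sq]
  rw [frob, this, Real.sq_sqrt]
  positivity

theorem frob_nonneg (A : Matrix ι κ ℝ) : 0 ≤ frob A := Real.sqrt_nonneg _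

theorem OpLE.frob (A : Matrix ι κ ℝ) : OpLE A (frob A) := fun v => by
  apply le_of_sq_le_sq _ (mul_nonneg (frob_nonneg A) (vnorm_nonneg v))
  rw [mul_pow, frob_sq, vnorm_sq_eq_sum, vnorm_sq_eq_sum, Finset.sum_mul]
  refine Finset.sum_le_sum fun i _ => ?_
  exact Finset.sum_mul_sq_le_sq_mul_sq _ _ _

theorem OpLE.diagonal [DecidableEq ι] {d : ι → ℝ} {C : ℝ} (hC : 0 ≤ C) (h : ∀ i, |d i| ≤ C) :
    OpLE (Matrix.diagonal d) C := fun v => by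
  apply le_of_sq_le_sq _ (mul_nonneg hC (vnorm_nonneg v))
  rw [mul_pow, vnorm_sq_eq_sum, vnorm_sq_eq_sum, Finset.mul_sum]
  refine Finset.sum_le_sum fun i _ => ?_
  rw [mulVec_diagonal, mul_pow]
  exact mul_le_mul_of_nonneg_right (sq_le_sq.mpr (by rw [abs_of_nonneg hC]; exact h i))
    (sq_nonneg _)

theorem OpLE.submatrix {A : Matrix ι κ ℝ} {a : ℝ} (hA : OpLE A a) {σ : Type*}
    [Fintype σ] {g : σ → ι} (hg : Function.Injective g) : OpLE (A.submatrix g id) a := fun v => by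
  refine le_trans ?_ (hA v)
  apply le_of_sq_le_sq _ (vnorm_nonneg _)
  rw [vnorm_sq_eq_sum, vnorm_sq_eq_sum]
  have : ∀ s, (A.submatrix g id *ᵥ v) s = (A *ᵥ v) (g s) := fun s => rfl
  simp only [this]
  classical
  rw [← Finset.sum_image (s := Finset.univ) (g := g) (f := fun i => (A *ᵥ v) i ^ 2)
    (fun a _ b _ h => hg h)]
  exact Finset.sum_le_sum_of_subset_of_nonneg (Finset.subset_univ _) fun i _ _ => sq_nonneg _

theorem abs_dotProduct_mulVec_le {A : Matrix ι ι ℝ} {C : ℝ} (hA : OpLE A C) (v : ι → ℝ) :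
    |v ⬝ᵥ A *ᵥ v| ≤ C * vnorm v ^ 2 :=
  calc |v ⬝ᵥ A *ᵥ v| ≤ vnorm v * vnorm (A *ᵥ v) := abs_dotProduct_le _ _
    _ ≤ vnorm v * (C * vnorm v) := mul_le_mul_of_nonneg_left (hA v) (vnorm_nonneg v)
    _ = C * vnorm v ^ 2 := by ring

end Euclidean

/-! ### Quadratic forms and ordered eigenvalues. -/

section Spectral

variable {ι : Type*} [Fintype ι]

theorem vnorm_sq_eq_sum_basis (b : OrthonormalBasis ι ℝ (EuclideanSpace ℝ ι)) (v : ι → ℝ) :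
    vnorm v ^ 2 = ∑ i, (⇑(b i) ⬝ᵥ v) ^ 2 := by
  rw [vnorm_eq_norm, ← b.sum_sq_inner_right]
  refine Finset.sum_congr rfl fun i _ => ?_
  rw [dotProduct_comm]
  rfl

variable [DecidableEq ι]

theorem dotProduct_mulVec_eq_sum_eigenvalues {A : Matrix ι ι ℝ} (hA : A.IsHermitian)
    (v : ι → ℝ) :
    v ⬝ᵥ A *ᵥ v = ∑ i, hA.eigenvalues i * (⇑(hA.eigenvectorBasis i) ⬝ᵥ v) ^ 2 := by
  have h := hA.eigenvectorBasis.sum_inner_mul_inner (WithLp.toLp 2 v) (WithLp.toLp 2 (A *ᵥ v))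
  have h1 : v ⬝ᵥ A *ᵥ v = inner ℝ (WithLp.toLp 2 v) (WithLp.toLp 2 (A *ᵥ v)) := by
    rw [dotProduct_comm]; rfl
  rw [h1, ← h]
  refine Finset.sum_congr rfl fun i _ => ?_
  have h2 : inner ℝ (WithLp.toLp 2 v) (hA.eigenvectorBasis i)
      = ⇑(hA.eigenvectorBasis i) ⬝ᵥ v := rfl
  have h3 : inner ℝ (hA.eigenvectorBasis i) (WithLp.toLp 2 (A *ᵥ v))
      = ⇑(hA.eigenvectorBasis i) ⬝ᵥ A *ᵥ v := by rw [dotProduct_comm]; rfl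
  rw [h2, h3, dotProduct_mulVec, ← mulVec_transpose]
  have hT : Aᵀ = A := by
    simpa [Matrix.conjTranspose_eq_transpose_of_trivial] using hA.eq
  rw [hT, hA.mulVec_eigenvectorBasis, smul_dotProduct, smul_eq_mul]
  ring

/-- The constant is the smallest eigenvalue, or `1` on an empty index type. -/
theorem _root_.Matrix.PosDef.exists_le_dotProduct {A : Matrix ι ι ℝ} (hA : A.PosDef) :
    ∃ c : ℝ, 0 < c ∧ ∀ v, c * vnorm v ^ 2 ≤ v ⬝ᵥ A *ᵥ v := by
  have hpos := hA.isHermitian.posDef_iff_eigenvalues_pos.mp hA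
  obtain ⟨c, hc, hle⟩ : ∃ c : ℝ, 0 < c ∧ ∀ i, c ≤ hA.isHermitian.eigenvalues i := by
    rcases isEmpty_or_nonempty ι with h | h
    · exact ⟨1, one_pos, fun i => h.elim i⟩
    · obtain ⟨i, hi⟩ := Finite.exists_min hA.isHermitian.eigenvalues
      exact ⟨_, hpos i, hi⟩
  refine ⟨c, hc, fun v => ?_⟩
  rw [dotProduct_mulVec_eq_sum_eigenvalues hA.isHermitian,
    vnorm_sq_eq_sum_basis hA.isHermitian.eigenvectorBasis, Finset.mul_sum]
  exact Finset.sum_le_sum fun i _ => mul_le_mul_of_nonneg_right (hle i) (sq_nonneg _)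

/-- A min-max bound: if the quadratic form of `A` is at least `c` on the `m + 1`-dimensional
range of `B`, then all eigenvalues up to the `m`-th are at least `c`. -/
theorem le_eigenvalues₀ {A : Matrix ι ι ℝ} (hA : A.IsHermitian) {m : ℕ}
    (hm : m < Fintype.card ι) (B : Matrix ι (Fin (m + 1)) ℝ) (hB : Function.Injective B.mulVec)
    {c : ℝ} (hc : ∀ a, c * vnorm (B *ᵥ a) ^ 2 ≤ (B *ᵥ a) ⬝ᵥ A *ᵥ (B *ᵥ a)) :
    c ≤ hA.eigenvalues₀ ⟨m, hm⟩ := by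
  -- The same enumeration as in the definition of `Matrix.IsHermitian.eigenvalues`, so that
  -- `eigenvalues (e l)` is `eigenvalues₀ l`.
  let e : Fin (Fintype.card ι) ≃ ι := Fintype.equivOfCardEq (Fintype.card_fin _)
  let Q : Matrix (Fin m) (Fin (m + 1)) ℝ := Matrix.of fun j a =>
    ⇑(hA.eigenvectorBasis (e ⟨j, j.2.trans hm⟩)) ⬝ᵥ (B.col a)
  have hQ : ∀ a j, (Q *ᵥ a) j =
      ⇑(hA.eigenvectorBasis (e ⟨j, j.2.trans hm⟩)) ⬝ᵥ (B *ᵥ a) := by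
    intro a j
    rw [dotProduct_mulVec]
    rfl
  -- Orthogonality to the first `m` eigenvectors is `m` linear conditions on `m + 1` coefficients. A
  -- nonzero solution gives a vector `B a` whose Rayleigh quotient is at most the `m`-th eigenvalue.
  obtain ⟨a, ha, ha0⟩ := (Submodule.ne_bot_iff _).mp
    (LinearMap.ker_ne_bot_of_finrank_lt (f := Q.mulVecLin) (by simp))
  have hzero : ∀ j : Fin m,
      ⇑(hA.eigenvectorBasis (e ⟨j, j.2.trans hm⟩)) ⬝ᵥ (B *ᵥ a) = 0 := by
    intro j
    rw [← hQ]
    exact congrFun (LinearMap.mem_ker.mp ha) j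
  have hv : 0 < vnorm (B *ᵥ a) := by
    refine (vnorm_nonneg _).lt_of_ne fun h => ha0 (hB ?_)
    simpa using vnorm_eq_zero h.symm
  have hle : (B *ᵥ a) ⬝ᵥ A *ᵥ (B *ᵥ a) ≤ hA.eigenvalues₀ ⟨m, hm⟩ * vnorm (B *ᵥ a) ^ 2 := by
    rw [dotProduct_mulVec_eq_sum_eigenvalues hA, vnorm_sq_eq_sum_basis hA.eigenvectorBasis,
      Finset.mul_sum]
    refine Finset.sum_le_sum fun i _ => ?_
    obtain ⟨l, rfl⟩ := e.surjective i
    by_cases hl : l.1 < m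
    · rw [hzero ⟨l, hl⟩]; simp
    · refine mul_le_mul_of_nonneg_right ?_ (sq_nonneg _)
      have : hA.eigenvalues (e l) = hA.eigenvalues₀ l := by
        simp [Matrix.IsHermitian.eigenvalues, e]
      rw [this]
      exact hA.eigenvalues₀_antitone (by simpa [Fin.le_def] using hl)
  exact le_of_mul_le_mul_right ((hc a).trans hle) (by positivity)

end Spectral

end FactorForecast

namespace FactorForecast

/-! ### Deterministic analysis of the principal components estimator. -/

section PrincipalComponents

variable {t N r : ℕ} {X E : Matrix (Fin t) (Fin N) ℝ} {F Fh : Matrix (Fin t) (Fin r) ℝ}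
  {L : Matrix (Fin N) (Fin r) ℝ} {l p q e b : ℝ}

/-- Test the Gram matrix on the column space of `F`. There `Xᵀv = L Fᵀv + Eᵀv`, with signal at least
`l p ‖v‖` and noise at most half of that. The min-max bound then controls the smallest of the `r`
eigenvalues, and monotonicity the others. -/
theorem le_pcEigenvalue (hX : X = F * Lᵀ + E) (hrt : r ≤ t) (hN : 0 < N)
    (hl : 0 < l) (hp : 0 < p) (hL : ∀ b, l * vnorm b ≤ vnorm (L *ᵥ b))
    (hF : ∀ a, p * vnorm a ≤ vnorm (F *ᵥ a)) (hE : OpLE E (l * p / 2)) {j : ℕ} (hj : j < r) :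
    (l * p) ^ 2 / (4 * (N * t)) ≤ pcEigenvalue X j := by
  obtain ⟨m, rfl⟩ : ∃ m, r = m + 1 := ⟨r - 1, by omega⟩
  have hm : m < Fintype.card (Fin t) := by simpa using hrt
  have ht : 0 < t := by omega
  have hj' : j < Fintype.card (Fin t) := by simp; omega
  have hinj : Function.Injective F.mulVec := by
    intro a a' h
    have h0 : F *ᵥ (a - a') = 0 := by rw [mulVec_sub]; exact sub_eq_zero.mpr h
    have h1 := hF (a - a')
    rw [h0, vnorm_zero] at h1
    have h2 : vnorm (a - a') = 0 := by nlinarith [vnorm_nonneg (a - a')]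
    exact sub_eq_zero.mp (vnorm_eq_zero h2)
  have key := le_eigenvalues₀ (scaledGram_isHermitian X) hm F hinj
    (c := (l * p) ^ 2 / (4 * (N * t))) fun a => by
    set v := F *ᵥ a with hv
    have h1 : v ⬝ᵥ scaledGram X *ᵥ v = ((N : ℝ) * t)⁻¹ * vnorm (Xᵀ *ᵥ v) ^ 2 := by
      rw [scaledGram, smul_mulVec, dotProduct_smul, smul_eq_mul, ← dotProduct_mulVec_self,
        transpose_transpose]
    have hXt : Xᵀ *ᵥ v = L *ᵥ (Fᵀ *ᵥ v) + Eᵀ *ᵥ v := by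
      rw [hX, transpose_add, transpose_mul, transpose_transpose, add_mulVec, ← mulVec_mulVec]
    have h2 : vnorm (L *ᵥ (Fᵀ *ᵥ v)) ≤ vnorm (Xᵀ *ᵥ v) + vnorm (Eᵀ *ᵥ v) := by
      have : L *ᵥ (Fᵀ *ᵥ v) = Xᵀ *ᵥ v - Eᵀ *ᵥ v := by rw [hXt]; abel
      rw [this]; exact vnorm_sub_le _ _
    -- `Fᵀ` inherits the lower bound of `F` on the range of `F`: `‖v‖² = a · Fᵀv ≤ ‖a‖ ‖Fᵀv‖ ≤ p⁻¹
    -- ‖v‖ ‖Fᵀv‖`.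
    have h3 : p * vnorm v ≤ vnorm (Fᵀ *ᵥ v) := by
      have h4 : vnorm v ^ 2 ≤ vnorm a * vnorm (Fᵀ *ᵥ v) := by
        rw [hv, ← dotProduct_mulVec_self, ← mulVec_mulVec]
        exact dotProduct_le_vnorm _ _
      rcases (vnorm_nonneg v).eq_or_lt with h0 | h0
      · rw [← h0, mul_zero]; exact vnorm_nonneg _
      · refine le_of_mul_le_mul_right ?_ h0
        have h5 := mul_le_mul_of_nonneg_right (hF a) (vnorm_nonneg (Fᵀ *ᵥ v))
        nlinarith
    have h4 := hE.transpose (by positivity) v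
    have h5 := hL (Fᵀ *ᵥ v)
    have h6 : l * p / 2 * vnorm v ≤ vnorm (Xᵀ *ᵥ v) := by
      have := mul_le_mul_of_nonneg_left h3 hl.le
      linarith
    rw [h1]
    have h7 : (l * p / 2 * vnorm v) ^ 2 ≤ vnorm (Xᵀ *ᵥ v) ^ 2 :=
      pow_le_pow_left₀ (mul_nonneg (by positivity) (vnorm_nonneg v)) h6 2
    calc (l * p) ^ 2 / (4 * (N * t)) * vnorm v ^ 2
        = ((N : ℝ) * t)⁻¹ * (l * p / 2 * vnorm v) ^ 2 := by
          field_simp; ring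
      _ ≤ _ := mul_le_mul_of_nonneg_left h7 (by positivity)
  rw [pcEigenvalue, dif_pos hj']
  exact key.trans ((scaledGram_isHermitian X).eigenvalues₀_antitone (by
    rw [Fin.le_def]; exact Nat.lt_succ_iff.mp hj))

theorem OpLE.pcFactors (hFh : IsPCFactors X Fh) : OpLE Fh (√t) := fun a => by
  apply le_of_sq_le_sq _ (mul_nonneg (Real.sqrt_nonneg _) (vnorm_nonneg a))
  rw [← dotProduct_mulVec_self, hFh.1, smul_mulVec, one_mulVec, dotProduct_smul, smul_eq_mul,
    ← vnorm_sq, mul_pow, Real.sq_sqrt (Nat.cast_nonneg t)]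

theorem vnorm_pcFactors_mulVec (hFh : IsPCFactors X Fh) (a : Fin r → ℝ) :
    vnorm (Fh *ᵥ a) = √t * vnorm a := by
  apply (pow_left_inj₀ (vnorm_nonneg _) (mul_nonneg (Real.sqrt_nonneg _) (vnorm_nonneg a))
    two_ne_zero).mp
  rw [← dotProduct_mulVec_self, hFh.1, smul_mulVec, one_mulVec, dotProduct_smul, smul_eq_mul,
    ← vnorm_sq, mul_pow, Real.sq_sqrt (Nat.cast_nonneg t)]

theorem pcDsq_inv_eq {c : ℝ} (hc : 0 < c) (h : ∀ j < r, c ≤ pcEigenvalue X j) :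
    (pcDsq r X)⁻¹ = Matrix.diagonal fun j : Fin r => (pcEigenvalue X j)⁻¹ := by
  apply Matrix.inv_eq_right_inv
  rw [pcDsq, diagonal_mul_diagonal, ← diagonal_one]
  congr 1
  funext j
  exact mul_inv_cancel₀ (hc.trans_le (h j j.2)).ne'

theorem OpLE.pcDsq_inv {c : ℝ} (hc : 0 < c) (h : ∀ j < r, c ≤ pcEigenvalue X j) :
    OpLE (pcDsq r X)⁻¹ c⁻¹ := by
  rw [pcDsq_inv_eq hc h]
  refine OpLE.diagonal (by positivity) fun j => ?_
  have hj := h j j.2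
  rw [abs_of_nonneg (by have := hc.trans_le hj; positivity)]
  exact inv_anti₀ hc hj

/-- Solve the eigenvalue equation for `Fh` and expand `X Xᵀ` into four products. The pure signal
term `F Lᵀ L Fᵀ` yields `F Hᵀ`; the other three remain. -/
theorem pcFactors_sub_eq (hX : X = F * Lᵀ + E) (hFh : IsPCFactors X Fh) {c : ℝ} (hc : 0 < c)
    (h : ∀ j < r, c ≤ pcEigenvalue X j) :
    Fh - F * (rotation X Fh F L)ᵀ = ((N : ℝ) * t)⁻¹ •
      ((F * (E * L)ᵀ * Fh + E * L * (Fᵀ * Fh) + E * (Eᵀ * Fh)) * (pcDsq r X)⁻¹) := by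
  have hD : pcDsq r X * (pcDsq r X)⁻¹ = 1 := by
    rw [pcDsq_inv_eq hc h, pcDsq, diagonal_mul_diagonal, ← diagonal_one]
    congr 1
    funext j
    exact mul_inv_cancel₀ (hc.trans_le (h j j.2)).ne'
  have hDt : ((pcDsq r X)⁻¹)ᵀ = (pcDsq r X)⁻¹ := by
    rw [pcDsq_inv_eq hc h, diagonal_transpose]
  have h1 : Fh = scaledGram X * Fh * (pcDsq r X)⁻¹ := by
    rw [hFh.2, Matrix.mul_assoc, hD, Matrix.mul_one]
  have h2 : F * (rotation X Fh F L)ᵀ =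
      ((N : ℝ) * t)⁻¹ • (F * (Lᵀ * L) * (Fᵀ * Fh) * (pcDsq r X)⁻¹) := by
    rw [rotation, transpose_mul, transpose_mul, hDt]
    simp only [transpose_smul, transpose_mul, transpose_transpose, Matrix.smul_mul,
      Matrix.mul_smul, smul_smul, Matrix.mul_assoc, mul_inv, mul_comm (t : ℝ)⁻¹]
  conv_lhs => rw [h2]; lhs; rw [h1]
  rw [scaledGram, hX]
  simp only [transpose_add, transpose_mul, transpose_transpose, Matrix.smul_mul, Matrix.mul_add,
    Matrix.add_mul, Matrix.mul_assoc, smul_add]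
  abel

/-- The two cross terms give `q b √t` each and the pure noise term `e² √t`. The inverse eigenvalues
contribute `4 N t / (l p)²`, whose `N t` cancels the normalization. -/
theorem OpLE.pcFactors_sub (hX : X = F * Lᵀ + E) (hFh : IsPCFactors X Fh) (hN : 0 < N)
    (ht : 0 < t) (hl : 0 < l) (hp : 0 < p)
    (h : ∀ j < r, (l * p) ^ 2 / (4 * (N * t)) ≤ pcEigenvalue X j)
    (hq : 0 ≤ q) (he : 0 ≤ e) (hb : 0 ≤ b)
    (hF : OpLE F q) (hE : OpLE E e) (hEL : OpLE (E * L) b) :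
    OpLE (Fh - F * (rotation X Fh F L)ᵀ) (4 / (l * p) ^ 2 * (2 * q * b + e ^ 2) * √t) := by
  have hc : 0 < (l * p) ^ 2 / (4 * ((N : ℝ) * t)) := by positivity
  rw [pcFactors_sub_eq hX hFh hc h]
  have h0 := OpLE.pcFactors hFh
  have hs := Real.sqrt_nonneg (t : ℝ)
  have h1 := ((((hF.mul hq (hEL.transpose hb)).mul (by positivity) h0).add
    (hEL.mul hb ((hF.transpose hq).mul hq h0))).add
    (hE.mul he ((hE.transpose he).mul he h0))).mul (by positivity) (OpLE.pcDsq_inv hc h)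
  refine (h1.smul _).mono (le_of_eq ?_)
  rw [abs_of_nonneg (by positivity)]
  field_simp
  ring

/-- Bounding the left side by `‖G‖ ‖v‖` would ignore the cancellation in sums against the forecast
errors. Letting `Fᵀ`, `(E L)ᵀ` and `Eᵀ` act on `v` first retains it, and gains a factor `T^{1/4}`
when `v` is the error vector. -/
theorem vnorm_pcFactors_sub_transpose_le (hX : X = F * Lᵀ + E) (hFh : IsPCFactors X Fh)
    (hN : 0 < N) (ht : 0 < t) (hl : 0 < l) (hp : 0 < p)
    (h : ∀ j < r, (l * p) ^ 2 / (4 * (N * t)) ≤ pcEigenvalue X j)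
    (hF : OpLE F q) (hE : OpLE E e) (hEL : OpLE (E * L) b) (v : Fin t → ℝ) :
    vnorm ((Fh - F * (rotation X Fh F L)ᵀ)ᵀ *ᵥ v) ≤ 4 / (l * p) ^ 2 * √t *
      (b * vnorm (Fᵀ *ᵥ v) + q * vnorm ((E * L)ᵀ *ᵥ v) + e * vnorm (Eᵀ *ᵥ v)) := by
  have hc : 0 < (l * p) ^ 2 / (4 * ((N : ℝ) * t)) := by positivity
  have hDt : ((pcDsq r X)⁻¹)ᵀ = (pcDsq r X)⁻¹ := by
    rw [pcDsq_inv_eq hc h, diagonal_transpose]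
  rw [pcFactors_sub_eq hX hFh hc h]
  have h0 := (OpLE.pcFactors hFh).transpose (Real.sqrt_nonneg _)
  have hs := Real.sqrt_nonneg (t : ℝ)
  have e1 : (((N : ℝ) * t)⁻¹ • ((F * (E * L)ᵀ * Fh + E * L * (Fᵀ * Fh) + E * (Eᵀ * Fh)) *
      (pcDsq r X)⁻¹))ᵀ *ᵥ v = ((N : ℝ) * t)⁻¹ • (pcDsq r X)⁻¹ *ᵥ (Fhᵀ *ᵥ
        ((E * L) *ᵥ (Fᵀ *ᵥ v) + F *ᵥ ((E * L)ᵀ *ᵥ v) + E *ᵥ (Eᵀ *ᵥ v))) := by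
    simp only [transpose_smul, transpose_mul, transpose_add, transpose_transpose, hDt,
      smul_mulVec, ← mulVec_mulVec, mulVec_add, add_mulVec, smul_add]
  rw [e1, vnorm_smul, abs_of_nonneg (by positivity)]
  have h1 : vnorm ((E * L) *ᵥ (Fᵀ *ᵥ v) + F *ᵥ ((E * L)ᵀ *ᵥ v) + E *ᵥ (Eᵀ *ᵥ v)) ≤
      b * vnorm (Fᵀ *ᵥ v) + q * vnorm ((E * L)ᵀ *ᵥ v) + e * vnorm (Eᵀ *ᵥ v) :=
    (vnorm_add_le _ _).trans (add_le_add ((vnorm_add_le _ _).trans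
      (add_le_add (hEL _) (hF _))) (hE _))
  have h2 := (OpLE.pcDsq_inv hc h (r := r)) (Fhᵀ *ᵥ
        ((E * L) *ᵥ (Fᵀ *ᵥ v) + F *ᵥ ((E * L)ᵀ *ᵥ v) + E *ᵥ (Eᵀ *ᵥ v)))
  have h3 := (h0 _).trans (mul_le_mul_of_nonneg_left h1 hs)
  have h4 := h2.trans (mul_le_mul_of_nonneg_left h3 (by positivity))
  refine (mul_le_mul_of_nonneg_left h4 (by positivity)).trans (le_of_eq ?_)
  field_simp

/-- Since `Fh` multiplies lengths by exactly `√t` and differs from `F Hᵀ` by at most `√t / 2` in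
operator norm, `F Hᵀ` expands by at least `√t / 2`, of which `F` accounts for at most `q`. -/
theorem le_vnorm_rotation_transpose (hFh : IsPCFactors X Fh) (hq : 0 < q) (hF : OpLE F q)
    (hG : OpLE (Fh - F * (rotation X Fh F L)ᵀ) (√t / 2)) (a : Fin r → ℝ) :
    √t / (2 * q) * vnorm a ≤ vnorm ((rotation X Fh F L)ᵀ *ᵥ a) := by
  have h1 := hF ((rotation X Fh F L)ᵀ *ᵥ a)
  have h2 := hG a
  have h3 : Fh *ᵥ a = F *ᵥ ((rotation X Fh F L)ᵀ *ᵥ a) +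
      (Fh - F * (rotation X Fh F L)ᵀ) *ᵥ a := by
    rw [sub_mulVec, mulVec_mulVec]; abel
  have h4 : √t * vnorm a ≤ q * vnorm ((rotation X Fh F L)ᵀ *ᵥ a) + √t / 2 * vnorm a := by
    rw [← vnorm_pcFactors_mulVec hFh, h3]
    exact (vnorm_add_le _ _).trans (add_le_add h1 h2)
  rw [div_mul_eq_mul_div, div_le_iff₀ (by positivity)]
  linarith

end PrincipalComponents

/-! ### Perturbation of least squares under estimated regressors. -/

section LeastSquares

theorem ols_eq {m : ℕ} {ι : Type*} [Fintype ι] [DecidableEq ι] (z : Fin m → ι → ℝ)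
    (y : Fin m → ℝ) :
    ols z y = ((Matrix.of z)ᵀ * Matrix.of z)⁻¹ *ᵥ ((Matrix.of z)ᵀ *ᵥ y) := by
  rw [ols]
  congr 1
  · congr 1
    ext i j
    simp [Matrix.sum_apply, vecMulVec_apply, Matrix.mul_apply]
  · ext i
    simp [Matrix.mulVec, dotProduct, mul_comm]

variable {ι κ : Type*} [Fintype ι] [Fintype κ]

/-- Cauchy–Schwarz applied to `a · ZᵀZ a = ‖Z a‖²`. Lower bounds of this kind stand in for norms of
inverses: they give invertibility and bound the solutions of the normal equations. -/
theorem sq_mul_vnorm_le {Z : Matrix ι κ ℝ} {c : ℝ} (hc : 0 ≤ c)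
    (hZ : ∀ a, c * vnorm a ≤ vnorm (Z *ᵥ a)) (a : κ → ℝ) :
    c ^ 2 * vnorm a ≤ vnorm ((Zᵀ * Z) *ᵥ a) := by
  rcases (vnorm_nonneg a).eq_or_lt with h | h
  · rw [← h, mul_zero]; exact vnorm_nonneg _
  · refine le_of_mul_le_mul_left ?_ h
    calc vnorm a * (c ^ 2 * vnorm a) = (c * vnorm a) ^ 2 := by ring
      _ ≤ vnorm (Z *ᵥ a) ^ 2 := pow_le_pow_left₀ (by positivity) (hZ a) 2
      _ = a ⬝ᵥ (Zᵀ * Z) *ᵥ a := (dotProduct_mulVec_self Z a).symm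
      _ ≤ _ := dotProduct_le_vnorm _ _

theorem isUnit_det_of_le [DecidableEq κ] {A : Matrix κ κ ℝ} {c : ℝ} (hc : 0 < c)
    (hA : ∀ a, c * vnorm a ≤ vnorm (A *ᵥ a)) : IsUnit A.det := by
  rw [isUnit_iff_ne_zero]
  intro h
  obtain ⟨v, hv, h0⟩ := Matrix.exists_mulVec_eq_zero_iff.mpr h
  have := hA v
  rw [h0, vnorm_zero] at this
  exact hv (vnorm_eq_zero (by nlinarith [vnorm_nonneg v]))

theorem normal_equation {m : ℕ} [DecidableEq κ] (z : Fin m → κ → ℝ) (y : Fin m → ℝ) {c : ℝ}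
    (hc : 0 < c) (hZ : ∀ a, c * vnorm a ≤ vnorm (Matrix.of z *ᵥ a)) :
    ((Matrix.of z)ᵀ * Matrix.of z) *ᵥ ols z y = (Matrix.of z)ᵀ *ᵥ y := by
  rw [ols_eq, mulVec_mulVec, Matrix.mul_nonsing_inv, one_mulVec]
  exact isUnit_det_of_le (by positivity) (sq_mul_vnorm_le hc.le hZ)

/-- Perturbation bound for least squares with estimated regressors `ẑ = Φ z + (0, g)`,
`Φ = diag(I, H)`. -/
theorem vnorm_ols_sub_le {m : ℕ} {K R : Type*} [Fintype K] [Fintype R] [DecidableEq K]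
    [DecidableEq R] (W : Matrix (Fin m) K ℝ) (F Fh : Matrix (Fin m) R ℝ) (H : Matrix R R ℝ)
    (δ : K ⊕ R → ℝ) (u y : Fin m → ℝ) {c h g qz qh β s s' : ℝ}
    (hy : y = fromCols W F *ᵥ δ + u) (hc : 0 < c) (hh : 0 < h) (hh1 : h ≤ 1)
    (hZ : ∀ a, c * vnorm a ≤ vnorm (fromCols W F *ᵥ a))
    (hH : ∀ a, h * vnorm a ≤ vnorm (Hᵀ *ᵥ a))
    (hg0 : 0 ≤ g) (hG : OpLE (Fh - F * Hᵀ) g) (hg : g ≤ c * h / 2)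
    (hqz : OpLE (fromCols W F) qz) (hqh0 : 0 ≤ qh) (hqh : OpLE (fromCols W Fh) qh)
    (hqz0 : 0 ≤ qz) (hβ : vnorm (fun j => δ (Sum.inr j)) ≤ β)
    (hs : vnorm ((fromCols W F)ᵀ *ᵥ u) ≤ s) (hs' : vnorm ((Fh - F * Hᵀ)ᵀ *ᵥ u) ≤ s') :
    vnorm (ols (fun i => Sum.elim (W i) (Fh i)) y -
      ((fromBlocks 1 0 0 H)⁻¹)ᵀ *ᵥ ols (fun i => Sum.elim (W i) (F i)) y) ≤
      (c * h / 2)⁻¹ ^ 2 * (s' + g * (qz * (s / c ^ 2)) +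
        qh * (g * ((β + s / c ^ 2) / h))) := by
  set G := Fh - F * Hᵀ with hGdef
  set Z := fromCols W F with hZdef
  set Zh := fromCols W Fh with hZhdef
  set Φ : Matrix (K ⊕ R) (K ⊕ R) ℝ := fromBlocks 1 0 0 H with hΦ
  have eZ : Matrix.of (fun i => Sum.elim (W i) (F i)) = Z := by
    ext i (j | j) <;> rfl
  have eZh : Matrix.of (fun i => Sum.elim (W i) (Fh i)) = Zh := by
    ext i (j | j) <;> rfl
  have hΦT : ∀ a : K ⊕ R → ℝ, Φᵀ *ᵥ a =
      Sum.elim (fun i => a (Sum.inl i)) (Hᵀ *ᵥ fun j => a (Sum.inr j)) := by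
    intro a
    rw [hΦ, fromBlocks_transpose, fromBlocks_mulVec]
    simp only [transpose_one, transpose_zero, one_mulVec, zero_mulVec, add_zero, zero_add]
    rfl
  -- On the known predictors `Φᵀ` is the identity, so `h ≤ 1` makes `h` a lower bound for both
  -- blocks.
  have hΦle : ∀ a, h * vnorm a ≤ vnorm (Φᵀ *ᵥ a) := by
    intro a
    apply le_of_sq_le_sq _ (vnorm_nonneg _)
    have e : a = Sum.elim (fun i => a (Sum.inl i)) (fun j => a (Sum.inr j)) := by
      ext (i | i) <;> rfl
    rw [hΦT, vnorm_sumElim_sq, mul_pow]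
    conv_lhs => rw [e, vnorm_sumElim_sq]
    have h1 := pow_le_pow_left₀ (mul_nonneg hh.le (vnorm_nonneg _))
      (hH (fun j => a (Sum.inr j))) 2
    have h2 : h ^ 2 ≤ 1 := by nlinarith
    nlinarith [mul_le_mul_of_nonneg_right h2 (sq_nonneg (vnorm fun i => a (Sum.inl i)))]
  have hZhd : ∀ a : K ⊕ R → ℝ, Zh *ᵥ a = Z *ᵥ (Φᵀ *ᵥ a) + G *ᵥ (fun j => a (Sum.inr j)) := by
    intro a
    rw [hΦT, hZhdef, hZdef, hGdef, fromCols_mulVec, fromCols_mulVec, sub_mulVec,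
      ← mulVec_mulVec]
    simp only [Sum.elim_comp_inl, Sum.elim_comp_inr]
    have : ∀ x y z w : Fin m → ℝ, x = z → y = w → ∀ v, x + y = z + v + (w - v) := by
      intro x y z w h1 h2 v; rw [h1, h2]; abel
    exact this _ _ _ _ rfl rfl _
  have hZhT : ∀ v, Zhᵀ *ᵥ v = Φ *ᵥ (Zᵀ *ᵥ v) + Sum.elim (0 : K → ℝ) (Gᵀ *ᵥ v) := by
    intro v
    rw [hZhdef, hZdef, hΦ, transpose_fromCols, transpose_fromCols, fromRows_mulVec,
      fromRows_mulVec, fromBlocks_mulVec, hGdef, transpose_sub, transpose_mul, transpose_transpose,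
      sub_mulVec, ← mulVec_mulVec]
    simp only [Sum.elim_comp_inl, Sum.elim_comp_inr, one_mulVec, zero_mulVec, add_zero, zero_add]
    ext (i | i)
    · simp
    · simp
  have hZhle : ∀ a, c * h / 2 * vnorm a ≤ vnorm (Zh *ᵥ a) := by
    intro a
    have h1 := hZ (Φᵀ *ᵥ a)
    have h2 := mul_le_mul_of_nonneg_left (hΦle a) hc.le
    have h3 := (hG (fun j => a (Sum.inr j))).trans
      (mul_le_mul_of_nonneg_left (vnorm_inr_le a) hg0)
    have h4 : Z *ᵥ (Φᵀ *ᵥ a) = Zh *ᵥ a - G *ᵥ (fun j => a (Sum.inr j)) := by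
      rw [hZhd]; abel
    have h5 := vnorm_sub_le (Zh *ᵥ a) (G *ᵥ (fun j => a (Sum.inr j)))
    rw [← h4] at h5
    have h6 := mul_le_mul_of_nonneg_right hg (vnorm_nonneg a)
    linarith
  have nZ := normal_equation (fun i => Sum.elim (W i) (F i)) y hc (by rw [eZ]; exact hZ)
  have nZh := normal_equation (fun i => Sum.elim (W i) (Fh i)) y (c := c * h / 2)
    (by positivity) (by rw [eZh]; exact hZhle)
  rw [eZ] at nZ
  rw [eZh] at nZh
  set d := ols (fun i => Sum.elim (W i) (F i)) y
  set dh := ols (fun i => Sum.elim (W i) (Fh i)) y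
  set γ := (Φ⁻¹)ᵀ *ᵥ d with hγ
  have hΦγ : Φᵀ *ᵥ γ = d := by
    rw [hγ, mulVec_mulVec, ← transpose_mul, Matrix.nonsing_inv_mul, transpose_one, one_mulVec]
    have := isUnit_det_of_le hh hΦle
    rwa [det_transpose] at this
  -- The error of the infeasible estimator solves `ZᵀZ (d - δ) = Zᵀu`.
  have hη : vnorm (d - δ) ≤ s / c ^ 2 := by
    rw [le_div_iff₀ (by positivity), mul_comm]
    refine (sq_mul_vnorm_le hc.le hZ (d - δ)).trans (le_trans (le_of_eq ?_) hs)
    congr 1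
    rw [mulVec_sub, nZ, hy, mulVec_add, mulVec_mulVec]
    abel
  have hdr : vnorm (fun j => d (Sum.inr j)) ≤ β + s / c ^ 2 := by
    have e : (fun j => d (Sum.inr j)) =
        (fun j => δ (Sum.inr j)) + fun j => (d - δ) (Sum.inr j) := by
      ext j; simp
    rw [e]
    exact (vnorm_add_le _ _).trans (add_le_add hβ ((vnorm_inr_le _).trans hη))
  -- The factor block of `γ` is mapped by `Hᵀ` to that of `d`. Only this block meets `G`, so the
  -- size of the coefficients of the known predictors plays no role.
  have hγr : vnorm (fun j => γ (Sum.inr j)) ≤ (β + s / c ^ 2) / h := by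
    rw [le_div_iff₀ hh, mul_comm]
    refine (hH _).trans (le_trans (le_of_eq ?_) hdr)
    congr 1
    rw [← hΦγ, hΦT]
    rfl
  have hres : y - Z *ᵥ d = u - Z *ᵥ (d - δ) := by
    rw [hy, mulVec_sub]; abel
  -- Expand `Zhᵀ(y - Zh γ)` with `Zh γ = Z d + G γ_R`. Of `Zhᵀ(y - Z d)` only the part through `Gᵀ`
  -- survives, since `Zᵀ(y - Z d) = 0`.
  have hmain : (Zhᵀ * Zh) *ᵥ (dh - γ) =
      Sum.elim (0 : K → ℝ) (Gᵀ *ᵥ u - Gᵀ *ᵥ (Z *ᵥ (d - δ))) -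
        Zhᵀ *ᵥ (G *ᵥ fun j => γ (Sum.inr j)) := by
    rw [mulVec_sub, nZh, ← mulVec_mulVec, hZhd γ, hΦγ, mulVec_add, ← sub_sub, ← mulVec_sub,
      hZhT (y - Z *ᵥ d), mulVec_sub Zᵀ, mulVec_mulVec, nZ, sub_self, mulVec_zero, zero_add,
      hres, mulVec_sub Gᵀ]
  have hfin := sq_mul_vnorm_le (by positivity : 0 ≤ c * h / 2) hZhle (dh - γ)
  rw [hmain] at hfin
  have hb1 : vnorm (Sum.elim (0 : K → ℝ) (Gᵀ *ᵥ u - Gᵀ *ᵥ (Z *ᵥ (d - δ)))) ≤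
      s' + g * (qz * (s / c ^ 2)) := by
    have e : vnorm (Sum.elim (0 : K → ℝ) (Gᵀ *ᵥ u - Gᵀ *ᵥ (Z *ᵥ (d - δ)))) =
        vnorm (Gᵀ *ᵥ u - Gᵀ *ᵥ (Z *ᵥ (d - δ))) := by
      apply (pow_left_inj₀ (vnorm_nonneg _) (vnorm_nonneg _) two_ne_zero).mp
      rw [vnorm_sumElim_sq]; simp
    rw [e]
    refine (vnorm_sub_le _ _).trans (add_le_add hs' ?_)
    refine (hG.transpose hg0 _).trans (mul_le_mul_of_nonneg_left ?_ hg0)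
    exact (hqz _).trans (mul_le_mul_of_nonneg_left hη hqz0)
  have hb2 : vnorm (Zhᵀ *ᵥ (G *ᵥ fun j => γ (Sum.inr j))) ≤
      qh * (g * ((β + s / c ^ 2) / h)) := by
    refine (hqh.transpose hqh0 _).trans (mul_le_mul_of_nonneg_left ?_ hqh0)
    exact (hG _).trans (mul_le_mul_of_nonneg_left hγr hg0)
  have hb := hfin.trans ((vnorm_sub_le _ _).trans (add_le_add hb1 hb2))
  rw [inv_pow, inv_mul_eq_div, le_div_iff₀ (by positivity), mul_comm]
  exact hb

end LeastSquares

end FactorForecast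

namespace FactorForecast

/-! ### The deterministic gap bound in the units `Q`, `a`, `b`. -/

section Gap

/-- For injective `g` the vector `v` is `u` padded with zeros. The factors use `t` rows and the
regression only `t - 1`; padding turns statements about the shorter sums into statements about the
full matrices. -/
theorem exists_transpose_mulVec_eq_submatrix {ι σ : Type*} [Fintype ι] [Fintype σ]
    [DecidableEq ι] (g : σ → ι) (u : σ → ℝ) :
    ∃ v : ι → ℝ, ∀ {m : ℕ} (A : Matrix ι (Fin m) ℝ),
      Aᵀ *ᵥ v = (A.submatrix g id)ᵀ *ᵥ u := by
  refine ⟨((1 : Matrix ι ι ℝ).submatrix g id)ᵀ *ᵥ u, fun A => ?_⟩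
  have h : A.submatrix g id = (1 : Matrix ι ι ℝ).submatrix g id * A := by
    ext i j
    simp [Matrix.mul_apply, Matrix.one_apply]
  rw [h, transpose_mul, mulVec_mulVec]

theorem OpLE.of_fromCols_left {m : Type*} [Fintype m] {K R : Type*} [Fintype K] [Fintype R]
    {A : Matrix m K ℝ} {B : Matrix m R ℝ} {c : ℝ} (h : OpLE (fromCols A B) c) : OpLE A c := by
  intro v
  have h1 := h (Sum.elim v 0)
  have h2 : vnorm (Sum.elim v (0 : R → ℝ)) = vnorm v := by
    apply (pow_left_inj₀ (vnorm_nonneg _) (vnorm_nonneg _) two_ne_zero).mp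
    rw [vnorm_sumElim_sq]; simp
  rw [fromCols_mulVec, h2] at h1
  simpa using h1

theorem OpLE.fromCols {m : Type*} [Fintype m] {K R : Type*} [Fintype K] [Fintype R]
    {A : Matrix m K ℝ} {B : Matrix m R ℝ} {a b : ℝ} (ha : 0 ≤ a) (hb : 0 ≤ b) (hA : OpLE A a)
    (hB : OpLE B b) : OpLE (fromCols A B) (a + b) := by
  intro v
  rw [fromCols_mulVec, add_mul]
  exact (vnorm_add_le _ _).trans (add_le_add
    ((hA _).trans (mul_le_mul_of_nonneg_left (vnorm_inl_le v) ha))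
    ((hB _).trans (mul_le_mul_of_nonneg_left (vnorm_inr_le v) hb)))

set_option maxHeartbeats 1000000 in
/-- Deterministic bound on the estimation gap at a fixed date, when sample size and strength are
parametrized by `T = Q⁴`, `N = a²` and `b² = N ^ α`. -/
theorem vnorm_gap_le {t N k r : ℕ} {X E : Matrix (Fin t) (Fin N) ℝ}
    {F Fh : Matrix (Fin t) (Fin r) ℝ} {L : Matrix (Fin N) (Fin r) ℝ}
    (W : Matrix (Fin (t - 1)) (Fin k) ℝ) (δ : Fin k ⊕ Fin r → ℝ) (u y : Fin (t - 1) → ℝ)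
    {Q a b C ρ : ℝ} (hX : X = F * Lᵀ + E) (hFh : IsPCFactors X Fh) (hrt : r ≤ t)
    (hQ : 1 ≤ Q) (ha : 1 ≤ a) (hb : 0 < b) (hC : 1 ≤ C) (hN : (N : ℝ) = a ^ 2)
    (htQ : (t : ℝ) ≤ Q ^ 4) (hQt : Q ^ 4 ≤ C ^ 2 * t)
    (hy : y = fromCols W (F.submatrix (Fin.castLE (Nat.sub_le t 1)) id) *ᵥ δ + u)
    (hL : ∀ v, b * vnorm v ≤ C * vnorm (L *ᵥ v))
    (hF : ∀ v, Q ^ 2 * vnorm v ≤ C * vnorm (F *ᵥ v))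
    (hZ : ∀ v, Q ^ 2 * vnorm v ≤
      C * vnorm (fromCols W (F.submatrix (Fin.castLE (Nat.sub_le t 1)) id) *ᵥ v))
    (hFop : OpLE F (C * Q ^ 2))
    (hZop : OpLE (fromCols W (F.submatrix (Fin.castLE (Nat.sub_le t 1)) id)) (C * Q ^ 2))
    (hE : OpLE E (C * (a + Q ^ 2))) (hEL : OpLE (E * L) (C * (a * Q ^ 2)))
    (hβ : vnorm (fun j => δ (Sum.inr j)) ≤ C / Q)
    (hZu : vnorm ((fromCols W (F.submatrix (Fin.castLE (Nat.sub_le t 1)) id))ᵀ *ᵥ u) ≤ C * Q ^ 3)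
    (hFu : vnorm ((F.submatrix (Fin.castLE (Nat.sub_le t 1)) id)ᵀ *ᵥ u) ≤ C * Q ^ 3)
    (hELu : vnorm (((E * L).submatrix (Fin.castLE (Nat.sub_le t 1)) id)ᵀ *ᵥ u) ≤
      C * (a * Q ^ 3))
    (hEu : vnorm ((E.submatrix (Fin.castLE (Nat.sub_le t 1)) id)ᵀ *ᵥ u) ≤ C * (a * Q ^ 3))
    (hρ : ρ = a / b ^ 2 + a ^ 2 / (b ^ 2 * Q ^ 2)) (hρs : 64 * C ^ 9 * ρ ≤ 1)
    (hsmall : 2 * C ^ 3 * (a + Q ^ 2) ≤ b * Q ^ 2) :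
    Q * vnorm (ols (fun i => Sum.elim (W i)
        ((Fh.submatrix (Fin.castLE (Nat.sub_le t 1)) id : Matrix (Fin (t - 1)) (Fin r) ℝ) i)) y -
      ((fromBlocks 1 0 0 (rotation X Fh F L))⁻¹)ᵀ *ᵥ ols (fun i => Sum.elim (W i)
        ((F.submatrix (Fin.castLE (Nat.sub_le t 1)) id : Matrix (Fin (t - 1)) (Fin r) ℝ) i)) y) ≤
      2500 * C ^ 18 * ρ := by
  set g : Fin (t - 1) → Fin t := Fin.castLE (Nat.sub_le t 1) with hg
  have hginj : Function.Injective g := Fin.castLE_injective _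
  have hQ0 : 0 < Q := by linarith
  have ha0 : 0 < a := by linarith
  have hC0 : 0 < C := by linarith
  have hNpos : 0 < N := by
    have : (0 : ℝ) < N := by rw [hN]; positivity
    exact_mod_cast this
  have htpos : 0 < t := by
    rcases Nat.eq_zero_or_pos t with h | h
    · rw [h] at hQt
      have : 0 < Q ^ 4 := by positivity
      simp at hQt; linarith
    · exact h
  have hst : √t ≤ Q ^ 2 := by
    rw [Real.sqrt_le_left (by positivity)]
    nlinarith
  have hts : Q ^ 2 / C ≤ √t := by
    apply Real.le_sqrt_of_sq_le
    rw [div_pow, div_le_iff₀ (by positivity)]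
    nlinarith
  have hρ0 : 0 ≤ ρ := by rw [hρ]; positivity
  have hl : 0 < b / C := by positivity
  have hp : 0 < Q ^ 2 / C := by positivity
  have hL' : ∀ v, b / C * vnorm v ≤ vnorm (L *ᵥ v) := fun v => by
    rw [div_mul_eq_mul_div, div_le_iff₀ hC0, mul_comm _ C]; exact hL v
  have hF' : ∀ v, Q ^ 2 / C * vnorm v ≤ vnorm (F *ᵥ v) := fun v => by
    rw [div_mul_eq_mul_div, div_le_iff₀ hC0, mul_comm _ C]; exact hF v
  have hZ' : ∀ v, Q ^ 2 / C * vnorm v ≤ vnorm (fromCols W (F.submatrix g id) *ᵥ v) := fun v => by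
    rw [div_mul_eq_mul_div, div_le_iff₀ hC0, mul_comm _ C]; exact hZ v
  -- This is exactly `hsmall`: the noise is at most half the signal, as `le_pcEigenvalue` requires.
  have hE' : OpLE E (b / C * (Q ^ 2 / C) / 2) := hE.mono (by
    rw [div_mul_div_comm, div_div, le_div_iff₀ (by positivity)]
    nlinarith)
  have hev : ∀ j < r, (b / C * (Q ^ 2 / C)) ^ 2 / (4 * (N * t)) ≤ pcEigenvalue X j := fun j hj =>
    le_pcEigenvalue hX hrt hNpos hl hp hL' hF' hE' hj
  have hG := OpLE.pcFactors_sub hX hFh hNpos htpos hl hp hev (by positivity) (by positivity)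
    (by positivity) hFop hE hEL
  have hG' : OpLE (Fh - F * (rotation X Fh F L)ᵀ) (16 * C ^ 6 * Q ^ 2 * ρ) := by
    refine hG.mono ?_
    -- From `(a + Q²)² ≤ 2 a² + 2 Q⁴`, then `a² ≤ a² Q²` and `Q⁴ ≤ a Q⁴`: every term becomes a
    -- multiple of one of the two parts of `ρ`.
    have h1 : 2 * (C * Q ^ 2) * (C * (a * Q ^ 2)) + (C * (a + Q ^ 2)) ^ 2 ≤
        C ^ 2 * (4 * (a * Q ^ 4) + 4 * (a ^ 2 * Q ^ 2)) := by
      have e : 2 * (C * Q ^ 2) * (C * (a * Q ^ 2)) + (C * (a + Q ^ 2)) ^ 2 =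
        C ^ 2 * (2 * (a * Q ^ 4) + (a + Q ^ 2) ^ 2) := by ring
      rw [e]
      refine mul_le_mul_of_nonneg_left ?_ (by positivity)
      have h2 : a ^ 2 * 1 ≤ a ^ 2 * Q ^ 2 :=
        mul_le_mul_of_nonneg_left (one_le_pow₀ hQ) (by positivity)
      have h3 : 1 * Q ^ 4 ≤ a * Q ^ 4 := mul_le_mul_of_nonneg_right ha (by positivity)
      nlinarith [sq_nonneg (a - Q ^ 2)]
    calc 4 / (b / C * (Q ^ 2 / C)) ^ 2 *
          (2 * (C * Q ^ 2) * (C * (a * Q ^ 2)) + (C * (a + Q ^ 2)) ^ 2) * √t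
        ≤ 4 / (b / C * (Q ^ 2 / C)) ^ 2 *
          (C ^ 2 * (4 * (a * Q ^ 4) + 4 * (a ^ 2 * Q ^ 2))) * Q ^ 2 := by gcongr
      _ = 16 * C ^ 6 * Q ^ 2 * ρ := by
        rw [hρ]; field_simp; ring
  -- Stated for vectors of length `t`, to be applied to the padded error vector.
  have hGv : ∀ v, vnorm (Fᵀ *ᵥ v) ≤ C * Q ^ 3 → vnorm ((E * L)ᵀ *ᵥ v) ≤ C * (a * Q ^ 3) →
      vnorm (Eᵀ *ᵥ v) ≤ C * (a * Q ^ 3) →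
      vnorm ((Fh - F * (rotation X Fh F L)ᵀ)ᵀ *ᵥ v) ≤ 12 * C ^ 6 * Q ^ 3 * ρ := by
    intro v h1 h2 h3
    have n1 := vnorm_nonneg (Fᵀ *ᵥ v)
    have n2 := vnorm_nonneg ((E * L)ᵀ *ᵥ v)
    have n3 := vnorm_nonneg (Eᵀ *ᵥ v)
    refine (vnorm_pcFactors_sub_transpose_le hX hFh hNpos htpos hl hp hev hFop hE hEL v).trans ?_
    calc 4 / (b / C * (Q ^ 2 / C)) ^ 2 * √t * (C * (a * Q ^ 2) * vnorm (Fᵀ *ᵥ v) +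
          C * Q ^ 2 * vnorm ((E * L)ᵀ *ᵥ v) + C * (a + Q ^ 2) * vnorm (Eᵀ *ᵥ v))
        ≤ 4 / (b / C * (Q ^ 2 / C)) ^ 2 * Q ^ 2 * (C * (a * Q ^ 2) * (C * Q ^ 3) +
          C * Q ^ 2 * (C * (a * Q ^ 3)) + C * (a + Q ^ 2) * (C * (a * Q ^ 3))) := by gcongr
      _ = 4 * C ^ 6 * Q ^ 3 * (3 * (a / b ^ 2) + a ^ 2 / (b ^ 2 * Q ^ 2)) := by
        field_simp; ring
      _ ≤ 4 * C ^ 6 * Q ^ 3 * (3 * (a / b ^ 2) + 3 * (a ^ 2 / (b ^ 2 * Q ^ 2))) := by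
        have : 0 ≤ a ^ 2 / (b ^ 2 * Q ^ 2) := by positivity
        gcongr
        linarith
      _ = 12 * C ^ 6 * Q ^ 3 * ρ := by rw [hρ]; ring
  have hGhalf : 16 * C ^ 6 * Q ^ 2 * ρ ≤ √t / 2 := by
    refine le_trans ?_ (div_le_div_of_nonneg_right hts (by norm_num))
    rw [div_div, le_div_iff₀ (by positivity)]
    have h1 : C ^ 7 * ρ ≤ C ^ 9 * ρ :=
      mul_le_mul_of_nonneg_right (pow_le_pow_right₀ hC (by norm_num)) hρ0
    have h2 : 32 * C ^ 7 * ρ ≤ 1 := by linarith [mul_nonneg (pow_nonneg hC0.le 9) hρ0]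
    linarith [mul_le_mul_of_nonneg_right h2 (sq_nonneg Q)]
  -- The constant is `√t / (2 q)` with `√t ≥ Q² / C` and `q = C Q²`.
  have hH : ∀ v, 1 / (2 * C ^ 2) * vnorm v ≤ vnorm ((rotation X Fh F L)ᵀ *ᵥ v) := fun v => by
    refine le_trans (mul_le_mul_of_nonneg_right ?_ (vnorm_nonneg v))
      (le_vnorm_rotation_transpose hFh (by positivity) hFop (hG'.mono hGhalf) v)
    rw [div_le_div_iff₀ (by positivity) (by positivity)]
    have := (div_le_iff₀ hC0).mp hts
    nlinarith
  have hsub : Fh.submatrix g id - F.submatrix g id * (rotation X Fh F L)ᵀ =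
      (Fh - F * (rotation X Fh F L)ᵀ).submatrix g id := by
    ext i j
    simp [Matrix.mul_apply]
  obtain ⟨v, hv⟩ := exists_transpose_mulVec_eq_submatrix g u
  have hmain := vnorm_ols_sub_le W (F.submatrix g id) (Fh.submatrix g id) (rotation X Fh F L)
    δ u y (c := Q ^ 2 / C) (h := 1 / (2 * C ^ 2)) (g := 16 * C ^ 6 * Q ^ 2 * ρ)
    (qz := C * Q ^ 2) (qh := C * Q ^ 2 + Q ^ 2) (β := C / Q) (s := C * Q ^ 3)
    (s' := 12 * C ^ 6 * Q ^ 3 * ρ) hy hp (by positivity)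
    (by
      rw [div_le_one (by positivity)]
      nlinarith)
    hZ' hH (by positivity)
    (by rw [hsub]; exact hG'.submatrix hginj)
    -- Here `c h / 2 = Q² / (4 C³)`, so the condition on `g` is precisely `64 C⁹ ρ ≤ 1`.
    (by
      have e : Q ^ 2 / C * (1 / (2 * C ^ 2)) / 2 = Q ^ 2 * (1 / (4 * C ^ 3)) := by
        field_simp; norm_num
      have h1 : 16 * C ^ 6 * ρ ≤ 1 / (4 * C ^ 3) := by
        rw [le_div_iff₀ (by positivity)]
        linarith
      rw [e]
      linarith [mul_le_mul_of_nonneg_left h1 (sq_nonneg Q)])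
    hZop (by positivity)
    (hZop.of_fromCols_left.fromCols (by positivity) (by positivity)
      (((OpLE.pcFactors hFh).mono hst).submatrix hginj))
    (by positivity) hβ hZu
    (by
      rw [hsub, ← hv]
      exact hGv v (by rw [hv]; exact hFu) (by rw [hv]; exact hELu) (by rw [hv]; exact hEu))
  refine (mul_le_mul_of_nonneg_left hmain hQ0.le).trans ?_
  have hs : C * Q ^ 3 / (Q ^ 2 / C) ^ 2 = C ^ 3 / Q := by field_simp
  rw [hs]
  have hCC : C / Q ≤ C ^ 3 / Q := by
    gcongr
    exact le_self_pow₀ hC (by norm_num)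
  have hqh : C * Q ^ 2 + Q ^ 2 ≤ 2 * C * Q ^ 2 := by nlinarith [sq_nonneg Q]
  calc Q * ((Q ^ 2 / C * (1 / (2 * C ^ 2)) / 2)⁻¹ ^ 2 * (12 * C ^ 6 * Q ^ 3 * ρ +
        16 * C ^ 6 * Q ^ 2 * ρ * (C * Q ^ 2 * (C ^ 3 / Q)) +
        (C * Q ^ 2 + Q ^ 2) * (16 * C ^ 6 * Q ^ 2 * ρ * ((C / Q + C ^ 3 / Q) /
          (1 / (2 * C ^ 2))))))
      ≤ Q * ((Q ^ 2 / C * (1 / (2 * C ^ 2)) / 2)⁻¹ ^ 2 * (12 * C ^ 6 * Q ^ 3 * ρ +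
        16 * C ^ 6 * Q ^ 2 * ρ * (C * Q ^ 2 * (C ^ 3 / Q)) +
        (2 * C * Q ^ 2) * (16 * C ^ 6 * Q ^ 2 * ρ * ((C ^ 3 / Q + C ^ 3 / Q) /
          (1 / (2 * C ^ 2)))))) := by gcongr
    _ = (192 * C ^ 12 + 256 * C ^ 16 + 2048 * C ^ 18) * ρ := by field_simp; ring
    _ ≤ (192 * C ^ 18 + 256 * C ^ 18 + 2048 * C ^ 18) * ρ := by
        gcongr <;> first | exact hC | norm_num
    _ = 2496 * C ^ 18 * ρ := by ring
    _ ≤ 2500 * C ^ 18 * ρ := by gcongr; norm_num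

end Gap

end FactorForecast

namespace FactorForecast

/-! ### Finite suprema. -/

section Suprema

theorem le_supIcc {a b t : ℕ} (g : ℕ → ℝ) (ha : a ≤ t) (hb : t ≤ b) : g t ≤ supIcc a b g :=
  le_ciSup (f := fun t : Set.Icc a b => g t) (Set.finite_range _).bddAbove ⟨t, ha, hb⟩

/-- The sign condition on `c` covers an empty range, where the supremum is `0`. -/
theorem supIcc_le {a b : ℕ} {g : ℕ → ℝ} {c : ℝ} (hc : 0 ≤ c)
    (h : ∀ t, a ≤ t → t ≤ b → g t ≤ c) : supIcc a b g ≤ c :=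
  Real.iSup_le (fun t => h t t.2.1 t.2.2) hc

theorem supIcc_nonneg {a b : ℕ} {g : ℕ → ℝ} (h : ∀ t, 0 ≤ g t) : 0 ≤ supIcc a b g :=
  Real.iSup_nonneg fun _ => h _

end Suprema

/-! ### Calculus of stochastic orders. -/

section StochasticOrder

variable {Ω : Type*} [MeasurableSpace Ω] {P : Measure Ω}

/-- Markov's inequality; `|M| + 1` keeps the constant positive for every `M`. -/
theorem isBigOp_of_integral_le {X : ℕ → Ω → ℝ} {c : ℕ → ℝ} {M : ℝ} (hX : ∀ n ω, 0 ≤ X n ω)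
    (hc : ∀ᶠ n in atTop, 0 < c n)
    (h : ∀ᶠ n in atTop, Integrable (X n) P ∧ ∫ ω, X n ω ∂P ≤ M * c n) : IsBigOp P X c := by
  intro ε hε
  refine ⟨(|M| + 1) / ε, by positivity, ?_⟩
  filter_upwards [hc, h] with n hcn ⟨hi, hle⟩
  have hpos : 0 < (|M| + 1) / ε * c n := by positivity
  have h1 := meas_ge_le_lintegral_div (μ := P) (f := fun ω => ENNReal.ofReal (X n ω))
    hi.aestronglyMeasurable.aemeasurable.ennreal_ofReal
    (ε := ENNReal.ofReal ((|M| + 1) / ε * c n)) (by simpa using hpos) (by simp)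
  refine (measure_mono ?_).trans (h1.trans ?_)
  · intro ω hω
    rw [Set.mem_ofPred_eq, abs_of_nonneg (hX n ω)] at hω
    exact ENNReal.ofReal_le_ofReal hω.le
  · rw [← ofReal_integral_eq_lintegral_ofReal hi (ae_of_all _ (hX n)),
      ← ENNReal.ofReal_div_of_pos hpos]
    apply ENNReal.ofReal_le_ofReal
    rw [div_le_iff₀ hpos]
    have : ε * ((|M| + 1) / ε * c n) = (|M| + 1) * c n := by field_simp
    rw [this]
    refine hle.trans (mul_le_mul_of_nonneg_right ?_ hcn.le)
    linarith [le_abs_self M]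

/-- Finitely many stochastic bounds hold simultaneously with a common constant. -/
theorem exists_forall_isBigOp {m : ℕ} {X : Fin m → ℕ → Ω → ℝ} {c : Fin m → ℕ → ℝ}
    (hc : ∀ i n, 0 ≤ c i n) (h : ∀ i, IsBigOp P (X i) (c i)) {ε : ℝ} (hε : 0 < ε) :
    ∃ C : ℝ, 1 ≤ C ∧ ∀ᶠ n in atTop,
      P {ω | ¬ ∀ i, |X i n ω| ≤ C * c i n} ≤ ENNReal.ofReal ε := by
  have hδ : 0 < ε / (m + 1) := by positivity
  choose C hC hCn using fun i => h i _ hδ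
  refine ⟨1 + ∑ i, C i, by
    linarith [Finset.sum_nonneg fun (i : Fin m) (_ : i ∈ Finset.univ) => (hC i).le], ?_⟩
  filter_upwards [eventually_all.mpr hCn] with n hn
  have hle : ∀ i, C i ≤ 1 + ∑ i, C i := fun i => by
    linarith [Finset.single_le_sum (f := C) (fun j _ => (hC j).le) (Finset.mem_univ i)]
  calc P {ω | ¬ ∀ i, |X i n ω| ≤ (1 + ∑ i, C i) * c i n}
      ≤ P (⋃ i, {ω | C i * c i n < |X i n ω|}) := by
        refine measure_mono fun ω hω => ?_
        rw [Set.mem_ofPred_eq] at hω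
        push Not at hω
        obtain ⟨i, hi⟩ := hω
        exact Set.mem_iUnion.mpr ⟨i, (mul_le_mul_of_nonneg_right (hle i) (hc i n)).trans_lt hi⟩
    _ ≤ ∑ i, P {ω | C i * c i n < |X i n ω|} := measure_iUnion_fintype_le _ _
    _ ≤ ∑ _i : Fin m, ENNReal.ofReal (ε / (m + 1)) := Finset.sum_le_sum fun i _ => hn i
    _ = ENNReal.ofReal (m * (ε / (m + 1))) := by
        rw [Finset.sum_const, Finset.card_univ, Fintype.card_fin, nsmul_eq_mul,
          ENNReal.ofReal_mul (Nat.cast_nonneg m), ENNReal.ofReal_natCast]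
    _ ≤ ENNReal.ofReal ε := by
        apply ENNReal.ofReal_le_ofReal
        rw [mul_div_assoc', div_le_iff₀ (by positivity)]
        nlinarith

theorem IsBigOp.isLittleOpOne {X : ℕ → Ω → ℝ} {c : ℕ → ℝ} (h : IsBigOp P X c)
    (hc : Tendsto c atTop (𝓝 0)) : IsLittleOpOne P X := by
  intro δ hδ
  rw [ENNReal.tendsto_nhds_zero]
  intro ε hε
  rcases eq_or_ne ε ⊤ with rfl | hεt
  · exact Eventually.of_forall fun n => le_top
  -- Convergence in measure quantifies over extended thresholds; distances between reals never reach
  -- `⊤`.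
  rcases eq_or_ne δ ⊤ with rfl | hδt
  · refine Eventually.of_forall fun n => ?_
    have : {ω | ⊤ ≤ edist (X n ω) 0} = ∅ := by
      ext ω; simp
    rw [this]; simp
  have hδ' := ENNReal.toReal_pos hδ.ne' hδt
  obtain ⟨C, hC, hn⟩ := h ε.toReal (ENNReal.toReal_pos hε.ne' hεt)
  have hlim : Tendsto (fun n => C * c n) atTop (𝓝 0) := by simpa using hc.const_mul C
  filter_upwards [hn, hlim.eventually_lt_const hδ'] with n hn1 hn2
  rw [ENNReal.ofReal_toReal hεt] at hn1
  refine (measure_mono fun ω hω => ?_).trans hn1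
  rw [Set.mem_ofPred_eq, edist_dist, Real.dist_eq, sub_zero] at hω
  exact hn2.trans_le ((ENNReal.le_ofReal_iff_toReal_le hδt (abs_nonneg _)).mp hω)

end StochasticOrder

/-! ### Moment bounds for products, and vanishing conditional means. -/

section Moments

variable {Ω : Type*} [MeasurableSpace Ω] {P : Measure Ω}

theorem MomentLE.four_of_eight [IsProbabilityMeasure P] {X Y : Ω → ℝ} {M : ℝ}
    (h : MomentLE P X 8 M) (hY : Measurable Y) (hle : ∀ ω, |Y ω| ≤ |X ω|) :
    MomentLE P Y 4 (1 + M) := by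
  have hb : ∀ ω, |Y ω| ^ 4 ≤ 1 + |X ω| ^ 8 := fun ω => by
    have h1 := pow_le_pow_left₀ (abs_nonneg _) (hle ω) 4
    nlinarith [sq_nonneg (|X ω| ^ 4 - 1)]
  have hi : Integrable (fun ω => 1 + |X ω| ^ 8) P := (integrable_const 1).add h.1
  refine ⟨hi.mono' (by fun_prop) (ae_of_all _ fun ω => ?_), ?_⟩
  · rw [Real.norm_eq_abs, abs_of_nonneg (by positivity)]; exact hb ω
  · refine (integral_mono_of_nonneg (ae_of_all _ fun ω => by positivity) hi
      (ae_of_all _ hb)).trans ?_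
    rw [integral_add (integrable_const 1) h.1]
    simpa using h.2

theorem MomentLE.memLp_mul {X Y : Ω → ℝ} {A B : ℝ} (hX : MomentLE P X 4 A)
    (hY : MomentLE P Y 4 B) (hXm : Measurable X) (hYm : Measurable Y) :
    MemLp (fun ω => X ω * Y ω) 2 P ∧ ∫ ω, (X ω * Y ω) ^ 2 ∂P ≤ A + B := by
  have hb : ∀ ω, (X ω * Y ω) ^ 2 ≤ |X ω| ^ 4 + |Y ω| ^ 4 := fun ω => by
    have h1 : |X ω| ^ 4 = (X ω ^ 2) ^ 2 := by
      rw [← sq_abs (X ω)]; ring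
    have h2 : |Y ω| ^ 4 = (Y ω ^ 2) ^ 2 := by
      rw [← sq_abs (Y ω)]; ring
    rw [h1, h2]
    nlinarith [sq_nonneg (X ω ^ 2 - Y ω ^ 2), sq_nonneg (X ω ^ 2), sq_nonneg (Y ω ^ 2)]
  have hi := hX.1.add hY.1
  have hint : Integrable (fun ω => (X ω * Y ω) ^ 2) P := by
    refine hi.mono' (by fun_prop) (ae_of_all _ fun ω => ?_)
    rw [Real.norm_eq_abs, abs_of_nonneg (by positivity)]; exact hb ω
  refine ⟨(memLp_two_iff_integrable_sq (by fun_prop)).mpr hint, ?_⟩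
  refine (integral_mono hint hi hb).trans ?_
  have := integral_add hX.1 hY.1
  simp only [Pi.add_apply] at this ⊢
  rw [this]
  exact add_le_add hX.2 hY.2

theorem MomentLE.memLp_two [IsFiniteMeasure P] {X : Ω → ℝ} {A : ℝ} (hX : MomentLE P X 4 A)
    (hXm : Measurable X) : MemLp X 2 P := by
  have h1 : MomentLE P (fun _ => (1 : ℝ)) 4 (∫ _, |(1 : ℝ)| ^ 4 ∂P) :=
    ⟨by simp, le_rfl⟩
  simpa using (hX.memLp_mul h1 hXm measurable_const).1

theorem integral_mul_eq_zero_of_condExp {Ω' : Type*} {m m0 : MeasurableSpace Ω'}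
    {P : Measure Ω'} [IsFiniteMeasure P] (hm : m ≤ m0) {f g : Ω' → ℝ} (hf : Measurable[m] f) (hg : Integrable g P)
    (hfg : Integrable (fun ω => f ω * g ω) P) (h0 : P[g|m] =ᵐ[P] 0) :
    ∫ ω, f ω * g ω ∂P = 0 := by
  rw [← integral_condExp hm]
  have h := condExp_mul_of_stronglyMeasurable_left (μ := P) (m := m) hf.stronglyMeasurable hfg hg
  rw [integral_congr_ae (g := fun _ => (0 : ℝ))]
  · simp
  · filter_upwards [h, h0] with ω h1 h2
    have h3 : (fun ω => f ω * g ω) = f * g := rfl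
    rw [h3, h1, Pi.mul_apply, h2]
    simp

end Moments

/-! ### A maximal inequality from orthogonality alone. -/

section PartialSums

theorem vnorm_sum_le {ι σ : Type*} [Fintype ι] (s : Finset σ) (x : σ → ι → ℝ) :
    vnorm (∑ i ∈ s, x i) ≤ ∑ i ∈ s, vnorm (x i) := by
  classical
  induction s using Finset.induction_on with
  | empty => simp
  | insert a s ha ih =>
    rw [Finset.sum_insert ha, Finset.sum_insert ha]
    exact (vnorm_add_le _ _).trans (add_le_add le_rfl ih)

theorem vnorm_sum_sq_le {ι σ : Type*} [Fintype ι] (s : Finset σ) (x : σ → ι → ℝ) :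
    vnorm (∑ i ∈ s, x i) ^ 2 ≤ s.card * ∑ i ∈ s, vnorm (x i) ^ 2 :=
  (pow_le_pow_left₀ (vnorm_nonneg _) (vnorm_sum_le s x) 2).trans sq_sum_le_card_mul_sum_sq

/-- Partial sums are controlled by those at multiples of `l` and the sum of squares. -/
theorem vnorm_partialSum_sq_le {ι : Type*} [Fintype ι] (x : ℕ → ι → ℝ) {l t n : ℕ} (hl : 0 < l)
    (ht : t ≤ n) :
    vnorm (∑ s ∈ Finset.range t, x s) ^ 2 ≤
      2 * ∑ b ∈ Finset.range (n / l + 1), vnorm (∑ s ∈ Finset.range (l * b), x s) ^ 2 +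
        2 * (l * ∑ s ∈ Finset.range n, vnorm (x s) ^ 2) := by
  have hle : l * (t / l) ≤ t := Nat.mul_div_le t l
  rw [← Finset.sum_range_add_sum_Ico _ hle]
  have h1 : vnorm (∑ s ∈ Finset.range (l * (t / l)), x s) ^ 2 ≤
      ∑ b ∈ Finset.range (n / l + 1), vnorm (∑ s ∈ Finset.range (l * b), x s) ^ 2 :=
    Finset.single_le_sum (f := fun b => vnorm (∑ s ∈ Finset.range (l * b), x s) ^ 2)
      (fun _ _ => sq_nonneg _)
      (Finset.mem_range.mpr (Nat.lt_succ_of_le (Nat.div_le_div_right ht)))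
  have h2 : vnorm (∑ s ∈ Finset.Ico (l * (t / l)) t, x s) ^ 2 ≤
      l * ∑ s ∈ Finset.range n, vnorm (x s) ^ 2 := by
    refine (vnorm_sum_sq_le _ _).trans (mul_le_mul ?_ ?_
      (Finset.sum_nonneg fun _ _ => sq_nonneg _) (Nat.cast_nonneg l))
    · rw [Nat.card_Ico]
      have := Nat.div_add_mod t l
      have := Nat.mod_lt t hl
      exact_mod_cast (by omega : t - l * (t / l) ≤ l)
    · refine Finset.sum_le_sum_of_subset_of_nonneg (fun s hs => ?_) fun _ _ _ => sq_nonneg _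
      rw [Finset.mem_Ico] at hs
      exact Finset.mem_range.mpr (hs.2.trans_le ht)
  have h3 := pow_le_pow_left₀ (vnorm_nonneg _) (vnorm_add_le
    (∑ s ∈ Finset.range (l * (t / l)), x s) (∑ s ∈ Finset.Ico (l * (t / l)) t, x s)) 2
  nlinarith [sq_nonneg (vnorm (∑ s ∈ Finset.range (l * (t / l)), x s) -
    vnorm (∑ s ∈ Finset.Ico (l * (t / l)) t, x s))]

variable {Ω : Type*} [MeasurableSpace Ω] {P : Measure Ω}

/-- Pythagoras in `L²`, one summand at a time. -/
theorem integral_sq_sum_of_orthogonal {x : ℕ → Ω → ℝ} {m : ℕ} {v : ℝ}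
    (hx : ∀ s < m, MemLp (x s) 2 P)
    (horth : ∀ s s', s < s' → s' < m → ∫ ω, x s ω * x s' ω ∂P = 0)
    (hv : ∀ s < m, ∫ ω, x s ω ^ 2 ∂P ≤ v) :
    ∫ ω, (∑ s ∈ Finset.range m, x s ω) ^ 2 ∂P ≤ m * v := by
  induction m with
  | zero => simp
  | succ m ih =>
    have ih' := ih (fun s hs => hx s (hs.trans m.lt_succ_self))
      (fun s s' h h' => horth s s' h (h'.trans m.lt_succ_self))
      (fun s hs => hv s (hs.trans m.lt_succ_self))
    have hS : MemLp (fun ω => ∑ s ∈ Finset.range m, x s ω) 2 P :=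
      memLp_finsetSum _ fun s hs => hx s ((Finset.mem_range.mp hs).trans m.lt_succ_self)
    have hm := hx m m.lt_succ_self
    have hcross : ∫ ω, (∑ s ∈ Finset.range m, x s ω) * x m ω ∂P = 0 := by
      simp_rw [Finset.sum_mul]
      rw [integral_finsetSum]
      · exact Finset.sum_eq_zero fun s hs => horth s m (Finset.mem_range.mp hs) m.lt_succ_self
      · intro s hs
        exact (hx s ((Finset.mem_range.mp hs).trans m.lt_succ_self)).integrable_mul hm
    have e : ∀ ω, (∑ s ∈ Finset.range (m + 1), x s ω) ^ 2 =
        (∑ s ∈ Finset.range m, x s ω) ^ 2 +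
          (2 * ((∑ s ∈ Finset.range m, x s ω) * x m ω) + x m ω ^ 2) := fun ω => by
      rw [Finset.sum_range_succ]; ring
    simp_rw [e]
    have hi : Integrable (fun ω => 2 * ((∑ s ∈ Finset.range m, x s ω) * x m ω)) P :=
      (hS.integrable_mul hm).const_mul 2
    have hi2 : Integrable (fun ω => 2 * ((∑ s ∈ Finset.range m, x s ω) * x m ω) + x m ω ^ 2) P :=
      hi.add hm.integrable_sq
    rw [integral_add hS.integrable_sq hi2, integral_add hi hm.integrable_sq,
      integral_const_mul, hcross]
    have := hv m m.lt_succ_self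
    push_cast
    linarith

/-- A maximal inequality for sums of orthogonal random vectors, up to a factor `√T`. -/
theorem exists_isBigOp_partialSum {ι : ℕ → Type*} [∀ n, Fintype (ι n)] {T : ℕ → ℕ}
    (hT : Tendsto T atTop atTop) (x : (n : ℕ) → ℕ → Ω → ι n → ℝ) {v : ℝ}
    (hι : ∀ᶠ n in atTop, 0 < Fintype.card (ι n))
    (hx : ∀ n s, s < T n - 1 → ∀ i, MemLp (fun ω => x n s ω i) 2 P)
    (horth : ∀ n s s', s < s' → s' < T n - 1 → ∀ i, ∫ ω, x n s ω i * x n s' ω i ∂P = 0)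
    (hv : ∀ n s, s < T n - 1 → ∀ i, ∫ ω, x n s ω i ^ 2 ∂P ≤ v) :
    ∃ Y : ℕ → Ω → ℝ, IsBigOp P Y (fun n => Fintype.card (ι n) * (√(T n) * T n)) ∧
      ∀ n ω t, t ≤ T n - 1 → vnorm (∑ s ∈ Finset.range t, x n s ω) ^ 2 ≤ Y n ω := by
  -- Block length about `√T` balances the two parts of the majorant: about `√T` block endpoints with
  -- mean square of order `T` per coordinate, and `l` times a sum of `T` squares. Both are of order
  -- `√T · T` per coordinate.
  set l : ℕ → ℕ := fun n => Nat.sqrt (T n) + 1 with hl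
  refine ⟨fun n ω => 2 * ∑ b ∈ Finset.range ((T n - 1) / l n + 1),
      vnorm (∑ s ∈ Finset.range (l n * b), x n s ω) ^ 2 +
        2 * (l n * ∑ s ∈ Finset.range (T n - 1), vnorm (x n s ω) ^ 2), ?_,
    fun n ω t ht => vnorm_partialSum_sq_le (fun s => x n s ω) (Nat.succ_pos _) ht⟩
  refine isBigOp_of_integral_le (M := 8 * |v|) ?_ ?_ ?_
  · intro n ω; positivity
  · filter_upwards [hι, hT.eventually_ge_atTop 1] with n h1 h2
    have : 0 < (T n : ℝ) := by exact_mod_cast h2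
    have : 0 < (Fintype.card (ι n) : ℝ) := by exact_mod_cast h1
    positivity
  · filter_upwards [hT.eventually_ge_atTop 1] with n hn
    have hTn : (1 : ℝ) ≤ T n := by exact_mod_cast hn
    have hsum : ∀ m ≤ T n - 1, Integrable
        (fun ω => vnorm (∑ s ∈ Finset.range m, x n s ω) ^ 2) P ∧
        ∫ ω, vnorm (∑ s ∈ Finset.range m, x n s ω) ^ 2 ∂P ≤
          Fintype.card (ι n) * (T n * |v|) := by
      intro m hm
      have hS : ∀ i, MemLp (fun ω => ∑ s ∈ Finset.range m, x n s ω i) 2 P := fun i =>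
        memLp_finsetSum _ fun s hs => hx n s ((Finset.mem_range.mp hs).trans_le hm) i
      simp_rw [vnorm_sq_eq_sum, Finset.sum_apply]
      refine ⟨integrable_finsetSum _ fun i _ => (hS i).integrable_sq, ?_⟩
      rw [integral_finsetSum _ fun i _ => (hS i).integrable_sq, ← nsmul_eq_mul,
        ← Finset.card_univ, ← Finset.sum_const]
      refine Finset.sum_le_sum fun i _ => ?_
      refine (integral_sq_sum_of_orthogonal (v := |v|) (fun s hs => hx n s (hs.trans_le hm) i)
        (fun s s' h h' => horth n s s' h (h'.trans_le hm) i)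
        (fun s hs => (hv n s (hs.trans_le hm) i).trans (le_abs_self v))).trans ?_
      refine mul_le_mul_of_nonneg_right ?_ (abs_nonneg v)
      exact_mod_cast hm.trans (Nat.sub_le _ _)
    have hsq : ∀ s < T n - 1, Integrable (fun ω => vnorm (x n s ω) ^ 2) P ∧
        ∫ ω, vnorm (x n s ω) ^ 2 ∂P ≤ Fintype.card (ι n) * |v| := by
      intro s hs
      simp_rw [vnorm_sq_eq_sum]
      refine ⟨integrable_finsetSum _ fun i _ => (hx n s hs i).integrable_sq, ?_⟩
      rw [integral_finsetSum _ fun i _ => (hx n s hs i).integrable_sq, ← nsmul_eq_mul,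
        ← Finset.card_univ, ← Finset.sum_const]
      exact Finset.sum_le_sum fun i _ => (hv n s hs i).trans (le_abs_self v)
    have hb : ∀ b ∈ Finset.range ((T n - 1) / l n + 1), l n * b ≤ T n - 1 := fun b hb =>
      (Nat.mul_le_mul_left _ (Nat.lt_succ_iff.mp (Finset.mem_range.mp hb))).trans
        (Nat.mul_div_le _ _)
    have i1 : Integrable (fun ω => ∑ b ∈ Finset.range ((T n - 1) / l n + 1),
        vnorm (∑ s ∈ Finset.range (l n * b), x n s ω) ^ 2) P :=
      integrable_finsetSum _ fun b h => (hsum _ (hb b h)).1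
    have i2 : Integrable (fun ω => ∑ s ∈ Finset.range (T n - 1), vnorm (x n s ω) ^ 2) P :=
      integrable_finsetSum _ fun s h => (hsq s (Finset.mem_range.mp h)).1
    have i3 : Integrable (fun ω => 2 * (l n * ∑ s ∈ Finset.range (T n - 1),
        vnorm (x n s ω) ^ 2)) P := (i2.const_mul _).const_mul 2
    refine ⟨(i1.const_mul 2).add i3, ?_⟩
    rw [integral_add (i1.const_mul 2) i3, integral_const_mul, integral_const_mul,
      integral_const_mul, integral_finsetSum _ fun b h => (hsum _ (hb b h)).1,
      integral_finsetSum _ fun s h => (hsq s (Finset.mem_range.mp h)).1]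
    have b1 := Finset.sum_le_card_nsmul _ _ _ fun b h => (hsum _ (hb b h)).2
    have b2 := Finset.sum_le_card_nsmul _ _ _ fun s h => (hsq s (Finset.mem_range.mp h)).2
    rw [Finset.card_range, nsmul_eq_mul] at b1 b2
    have hsqrt : (1 : ℝ) ≤ √(T n) := Real.one_le_sqrt.mpr hTn
    have hl2 : ((l n : ℕ) : ℝ) ≤ 2 * √(T n) := by
      have : (Nat.sqrt (T n) : ℝ) ≤ √(T n) := Real.nat_sqrt_le_real_sqrt
      rw [hl]; push_cast; linarith
    have hd : (((T n - 1) / l n + 1 : ℕ) : ℝ) ≤ 2 * √(T n) := by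
      refine le_trans ?_ hl2
      have : (T n - 1) / l n ≤ Nat.sqrt (T n) := by
        rw [Nat.div_le_iff_le_mul_add_pred (Nat.succ_pos _)]
        have h1 := Nat.lt_succ_sqrt (T n)
        have h2 : (Nat.sqrt (T n) + 1) * (Nat.sqrt (T n) + 1) =
            (Nat.sqrt (T n) + 1) * Nat.sqrt (T n) + Nat.sqrt (T n) + 1 := by ring
        simp only [Nat.succ_eq_add_one] at h1 ⊢
        omega
      exact_mod_cast Nat.succ_le_succ this
    have hT1 : ((T n - 1 : ℕ) : ℝ) ≤ T n := by exact_mod_cast Nat.sub_le _ _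
    have hcard : (0 : ℝ) ≤ Fintype.card (ι n) := Nat.cast_nonneg _
    have hv0 := abs_nonneg v
    calc _ ≤ 2 * ((2 * √(T n)) * (Fintype.card (ι n) * (T n * |v|))) +
          2 * ((2 * √(T n)) * (T n * (Fintype.card (ι n) * |v|))) := by
          refine add_le_add (mul_le_mul_of_nonneg_left (b1.trans ?_) (by norm_num))
            (mul_le_mul_of_nonneg_left (mul_le_mul hl2 (b2.trans ?_) ?_ (by positivity))
              (by norm_num))
          · exact mul_le_mul_of_nonneg_right hd (by positivity)
          · exact mul_le_mul_of_nonneg_right hT1 (by positivity)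
          · exact Finset.sum_nonneg fun s _ => integral_nonneg fun ω => sq_nonneg _
      _ = _ := by ring

end PartialSums

end FactorForecast

namespace FactorForecast

/-! ### Uniform stochastic bounds for the panel. -/

namespace Panel

variable {Ω : Type*} {k r : ℕ} {D : Panel Ω k r}

theorem measurable_z_info {n s t : ℕ} (hs : 1 ≤ s) (hst : s ≤ t) :
    Measurable[D.info n t] (D.z n s) := by
  refine Measurable.mono (comap_measurable (D.z n s)) ?_ le_rfl
  exact le_trans (le_trans le_sup_left le_sup_left)
    (le_iSup (fun s : Set.Icc 1 t => MeasurableSpace.comap (D.z n s) inferInstance ⊔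
      MeasurableSpace.comap (D.x n s) inferInstance ⊔
      MeasurableSpace.comap (D.y n s) inferInstance) ⟨s, hs, hst⟩)

theorem measurable_y_info {n s t : ℕ} (hs : 1 ≤ s) (hst : s ≤ t) :
    Measurable[D.info n t] (D.y n s) := by
  refine Measurable.mono (comap_measurable (D.y n s)) ?_ le_rfl
  exact le_trans le_sup_right
    (le_iSup (fun s : Set.Icc 1 t => MeasurableSpace.comap (D.z n s) inferInstance ⊔
      MeasurableSpace.comap (D.x n s) inferInstance ⊔
      MeasurableSpace.comap (D.y n s) inferInstance) ⟨s, hs, hst⟩)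

/-- The errors do not generate the filtration, but the forecasting equation recovers `u_{s+1}` from
`y_{s+1}` and `z_s`. -/
theorem measurable_u_info {θ : Fin k → ℝ} {β0 : Fin r → ℝ} (hmod : D.IsModel θ β0) {n s t : ℕ}
    (hs : 1 ≤ s) (hst : s + 1 ≤ t) (hsT : s < D.T n) :
    Measurable[D.info n t] (D.u n (s + 1)) := by
  have e : D.u n (s + 1) = fun ω => D.y n (s + 1) ω - (∑ j, θ j * D.z n s ω (Sum.inl j) +
      ∑ j, (((D.T n : ℝ) ^ (-(1 / 4) : ℝ)) • β0) j * D.z n s ω (Sum.inr j)) := by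
    funext ω
    rw [hmod n s hs hsT ω]
    simp only [dotProduct, z, Sum.elim_inl, Sum.elim_inr]
    ring
  have hz := measurable_z_info (D := D) (n := n) hs (Nat.le_of_succ_le hst)
  rw [e]
  refine (measurable_y_info (by omega) hst).sub (Measurable.add ?_ ?_)
  · exact Finset.measurable_sum _ fun j _ => ((measurable_pi_apply _).comp hz).const_mul _
  · exact Finset.measurable_sum _ fun j _ => ((measurable_pi_apply _).comp hz).const_mul _

theorem Binv_mulVec_apply (a : Fin r → ℝ) (n : ℕ) (v : Fin r → ℝ) (j : Fin r) :
    (D.Binv a n *ᵥ v) j = (D.N n : ℝ) ^ (-(a j / 2)) * v j := by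
  rw [Binv, mulVec_diagonal]

/-- The normalized noise `B_N⁻¹ Λ'e_t`. -/
noncomputable def noise (D : Panel Ω k r) (a : Fin r → ℝ) (n t : ℕ) (ω : Ω) : Fin r → ℝ :=
  D.Binv a n *ᵥ ((D.lam n ω)ᵀ *ᵥ D.e n t ω)

theorem measurable_noise_fun (a : Fin r → ℝ) (n : ℕ) (i : Fin r) :
    Measurable fun p : (Fin (D.N n) → Fin r → ℝ) × (Fin (D.N n) → ℝ) =>
      (D.Binv a n *ᵥ ((Matrix.of p.1)ᵀ *ᵥ p.2)) i := by
  simp only [Matrix.mulVec, dotProduct, transpose_apply, of_apply]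
  fun_prop

variable [MeasurableSpace Ω] {P : Measure Ω}

theorem measurable_z (hm : D.IsMeasurable) (n t : ℕ) : Measurable (D.z n t) := by
  refine measurable_pi_iff.mpr fun j => ?_
  rcases j with j | j
  · exact (measurable_pi_apply j).comp (hm.w n t)
  · exact (measurable_pi_apply j).comp (hm.f n t)

theorem measurable_x (hm : D.IsMeasurable) (n t : ℕ) : Measurable (D.x n t) := by
  refine measurable_pi_iff.mpr fun i => ?_
  have h1 : Measurable fun ω => ∑ j, D.lam n ω i j * D.f n t ω j :=
    Finset.measurable_sum _ fun j _ =>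
      (hm.lam n i j).mul ((measurable_pi_apply j).comp (hm.f n t))
  exact h1.add ((measurable_pi_apply i).comp (hm.e n t))

theorem info_le (hm : D.IsMeasurable) (n t : ℕ) : D.info n t ≤ ‹MeasurableSpace Ω› :=
  iSup_le fun s => sup_le (sup_le (measurable_z hm n s).comap_le (measurable_x hm n s).comap_le)
    (hm.y n s).comap_le

variable [IsProbabilityMeasure P]

theorem integral_u_mul_u {θ : Fin k → ℝ} {β0 : Fin r → ℝ} (hm : D.IsMeasurable)
    (hmod : D.IsModel θ β0) (hu : D.ForecastError P) {n s t : ℕ} (hs : 1 ≤ s) (hst : s < t)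
    (ht : t < D.T n) : ∫ ω, D.u n (s + 1) ω * D.u n (t + 1) ω ∂P = 0 := by
  obtain ⟨M, hM⟩ := hu.moment
  have h1 := (hM n s hs (hst.trans ht)).memLp_two (hm.u n (s + 1))
  have h2 := (hM n t (by omega) ht).memLp_two (hm.u n (t + 1))
  obtain ⟨hi, hc⟩ := hu.mds n t (by omega) ht
  exact integral_mul_eq_zero_of_condExp (info_le hm n t)
    (measurable_u_info hmod hs hst (hst.trans ht)) hi (h1.integrable_mul h2) hc

theorem exists_moment_z (hm : D.IsMeasurable) {π₀ : ℝ}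
    {Sz : Matrix (Fin k ⊕ Fin r) (Fin k ⊕ Fin r) ℝ} (hz : D.Predictors P π₀ Sz) :
    ∃ M, ∀ n t, 1 ≤ t → t ≤ D.T n → ∀ j, MomentLE P (fun ω => D.z n t ω j) 4 M := by
  obtain ⟨M, hM⟩ := hz.moment
  exact ⟨1 + M, fun n t h1 h2 j => (hM n t h1 h2).four_of_eight
    ((measurable_pi_apply j).comp (measurable_z hm n t)) fun ω =>
      (abs_apply_le_vnorm _ j).trans (le_abs_self _)⟩

/-- Uniform bound for the scores `∑ z_s u_{s+1}`. -/
theorem exists_isBigOp_sum_z_u {θ : Fin k → ℝ} {β0 : Fin r → ℝ} (hr : 0 < r)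
    (hm : D.IsMeasurable) (hmod : D.IsModel θ β0) (hu : D.ForecastError P) {π₀ : ℝ}
    {Sz : Matrix (Fin k ⊕ Fin r) (Fin k ⊕ Fin r) ℝ} (hz : D.Predictors P π₀ Sz)
    (hT : Tendsto D.T atTop atTop) :
    ∃ Y : ℕ → Ω → ℝ,
      IsBigOp P Y (fun n => Fintype.card (Fin k ⊕ Fin r) * (√(D.T n) * D.T n)) ∧
      ∀ n ω t, t ≤ D.T n - 1 →
        vnorm (∑ s ∈ Finset.range t, D.u n (s + 2) ω • D.z n (s + 1) ω) ^ 2 ≤ Y n ω := by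
  obtain ⟨M, hM⟩ := hu.moment
  obtain ⟨A, hA⟩ := exists_moment_z hm hz
  have hzm : ∀ n t j, Measurable fun ω => D.z n t ω j := fun n t j =>
    (measurable_pi_apply j).comp (measurable_z hm n t)
  have key : ∀ n s, s < D.T n - 1 → ∀ j : Fin k ⊕ Fin r,
      MemLp (fun ω => D.u n (s + 2) ω * D.z n (s + 1) ω j) 2 P ∧
      ∫ ω, (D.u n (s + 2) ω * D.z n (s + 1) ω j) ^ 2 ∂P ≤ M + A := fun n s hs j =>
    (hM n (s + 1) (by omega) (by omega)).memLp_mul (hA n (s + 1) (by omega) (by omega) j)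
      (hm.u n (s + 2)) (hzm n (s + 1) j)
  refine exists_isBigOp_partialSum (ι := fun _ => Fin k ⊕ Fin r) hT
    (fun n s ω => D.u n (s + 2) ω • D.z n (s + 1) ω) (v := M + A)
    (Eventually.of_forall fun n => by simp; omega)
    (fun n s hs j => (key n s hs j).1) ?_ (fun n s hs j => (key n s hs j).2)
  intro n s t hst ht j
  obtain ⟨hi, hc⟩ := hu.mds n (t + 1) (by omega) (by omega)
  -- Everything but the later error is known at time `t + 1`, because `s + 2 ≤ t + 1`; the
  -- martingale difference property kills the product.
  have e : ∀ ω, (D.u n (s + 2) ω • D.z n (s + 1) ω) j * (D.u n (t + 2) ω • D.z n (t + 1) ω) j =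
      (D.u n (s + 2) ω * D.z n (s + 1) ω j * D.z n (t + 1) ω j) * D.u n (t + 2) ω := fun ω => by
    simp only [Pi.smul_apply, smul_eq_mul]; ring
  simp_rw [e]
  refine integral_mul_eq_zero_of_condExp (info_le hm n (t + 1)) ?_ hi ?_ hc
  · refine Measurable.mul (Measurable.mul ?_ ?_) ?_
    · exact measurable_u_info hmod (by omega) (by omega) (by omega)
    · exact (measurable_pi_apply j).comp (measurable_z_info (by omega) (by omega))
    · exact (measurable_pi_apply j).comp (measurable_z_info (by omega) (by omega))
  · refine ((key n s (hst.trans ht) j).1.integrable_mul (key n t ht j).1).congr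
      (ae_of_all _ fun ω => ?_)
    exact e ω

/-- Uniform bound for `∑ g_s u_{s+1}`, where `g_s` is a function of the loadings and of `e_s`. -/
theorem exists_isBigOp_sum_noise_u {θ : Fin k → ℝ} {β0 : Fin r → ℝ}
    (hm : D.IsMeasurable) (hmod : D.IsModel θ β0) (hu : D.ForecastError P)
    (hT : Tendsto D.T atTop atTop) {ι : ℕ → Type*} [∀ n, Fintype (ι n)]
    (hι : ∀ᶠ n in atTop, 0 < Fintype.card (ι n))
    (g : (n : ℕ) → Matrix (Fin (D.N n)) (Fin r) ℝ → (Fin (D.N n) → ℝ) → ι n → ℝ)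
    (hg : ∀ n i, Measurable fun p : (Fin (D.N n) → Fin r → ℝ) × (Fin (D.N n) → ℝ) =>
      g n (Matrix.of p.1) p.2 i)
    {A : ℝ} (hA : ∀ n t, 1 ≤ t → t ≤ D.T n → ∀ i,
      MomentLE P (fun ω => g n (D.lam n ω) (D.e n t ω) i) 4 A) :
    ∃ Y : ℕ → Ω → ℝ,
      IsBigOp P Y (fun n => Fintype.card (ι n) * (√(D.T n) * D.T n)) ∧
      ∀ n ω t, t ≤ D.T n - 1 →
        vnorm (∑ s ∈ Finset.range t, D.u n (s + 2) ω • g n (D.lam n ω) (D.e n (s + 1) ω)) ^ 2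
          ≤ Y n ω := by
  obtain ⟨M, hM⟩ := hu.moment
  have hlam : ∀ n, Measurable fun ω => (fun i j => D.lam n ω i j : Fin (D.N n) → Fin r → ℝ) :=
    fun n => measurable_pi_iff.mpr fun i => measurable_pi_iff.mpr fun j => hm.lam n i j
  have hgm : ∀ n t i, Measurable fun ω => g n (D.lam n ω) (D.e n t ω) i := fun n t i =>
    (hg n i).comp ((hlam n).prodMk (hm.e n t))
  have key : ∀ n s, s < D.T n - 1 → ∀ i,
      MemLp (fun ω => D.u n (s + 2) ω * g n (D.lam n ω) (D.e n (s + 1) ω) i) 2 P ∧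
      ∫ ω, (D.u n (s + 2) ω * g n (D.lam n ω) (D.e n (s + 1) ω) i) ^ 2 ∂P ≤ M + A :=
    fun n s hs i => (hM n (s + 1) (by omega) (by omega)).memLp_mul
      (hA n (s + 1) (by omega) (by omega) i) (hm.u n (s + 2)) (hgm n (s + 1) i)
  refine exists_isBigOp_partialSum hT
    (fun n s ω => D.u n (s + 2) ω • g n (D.lam n ω) (D.e n (s + 1) ω)) (v := M + A) hι
    (fun n s hs i => (key n s hs i).1) ?_ (fun n s hs i => (key n s hs i).2)
  intro n s t hst ht i
  have e : ∀ ω, (D.u n (s + 2) ω • g n (D.lam n ω) (D.e n (s + 1) ω)) i *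
      (D.u n (t + 2) ω • g n (D.lam n ω) (D.e n (t + 1) ω)) i =
      (D.u n (s + 2) ω * D.u n (t + 2) ω) *
        (g n (D.lam n ω) (D.e n (s + 1) ω) i * g n (D.lam n ω) (D.e n (t + 1) ω) i) := fun ω => by
    simp only [Pi.smul_apply, smul_eq_mul]; ring
  simp_rw [e]
  -- The functions of `Λ` and `e` need not be measurable for the filtration. Independence factors
  -- the expectation instead, and the factor `E(u_{s+2} u_{t+2})` vanishes.
  let φ : (Set.Icc 2 (D.T n) → ℝ) → ℝ := fun u =>
    u ⟨s + 2, by omega, by omega⟩ * u ⟨t + 2, by omega, by omega⟩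
  let ψ : (Fin (D.N n) → Fin r → ℝ) × (Set.Icc 1 (D.T n) → Fin r → ℝ) ×
      (Set.Icc 1 (D.T n) → Fin (D.N n) → ℝ) → ℝ := fun p =>
    g n (Matrix.of p.1) (p.2.2 ⟨s + 1, by omega, by omega⟩) i *
      g n (Matrix.of p.1) (p.2.2 ⟨t + 1, by omega, by omega⟩) i
  have hφ : Measurable φ := (measurable_pi_apply _).mul (measurable_pi_apply _)
  have hψ : Measurable ψ := by
    have h1 : ∀ a : Set.Icc 1 (D.T n), Measurable fun p : (Fin (D.N n) → Fin r → ℝ) ×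
        (Set.Icc 1 (D.T n) → Fin r → ℝ) × (Set.Icc 1 (D.T n) → Fin (D.N n) → ℝ) =>
        g n (Matrix.of p.1) (p.2.2 a) i := fun a =>
      (hg n i).comp (measurable_fst.prodMk
        ((measurable_pi_apply a).comp (measurable_snd.comp measurable_snd)))
    exact (h1 _).mul (h1 _)
  have hind := (hu.indep n).comp hφ hψ
  have hprod := hind.integral_fun_mul_eq_mul_integral
    (((hm.u n (s + 2)).mul (hm.u n (t + 2))).aestronglyMeasurable)
    (((hgm n (s + 1) i).mul (hgm n (t + 1) i)).aestronglyMeasurable)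
  have h0 := integral_u_mul_u hm hmod hu (n := n) (s := s + 1) (t := t + 1) (by omega)
    (by omega) (by omega)
  refine hprod.trans ?_
  have : ∫ ω, (φ ∘ fun ω (t : Set.Icc 2 (D.T n)) => D.u n t ω) ω ∂P = 0 := h0
  rw [this, zero_mul]

/-- A sum of fourth powers of order `T` bounds every single `‖z_t‖²` by order `√T`. This pays for
dropping the last row of the design: the law of large numbers concerns `t ≥ k₀` terms, the
regression uses `t - 1`. -/
theorem isBigOp_sum_z (hm : D.IsMeasurable) {π₀ : ℝ}
    {Sz : Matrix (Fin k ⊕ Fin r) (Fin k ⊕ Fin r) ℝ} (hz : D.Predictors P π₀ Sz)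
    (hT : Tendsto D.T atTop atTop) :
    IsBigOp P (fun n ω => ∑ s ∈ Finset.range (D.T n), vnorm (D.z n (s + 1) ω) ^ 4)
      (fun n => D.T n) := by
  obtain ⟨M, hM⟩ := hz.moment
  have hv : ∀ n t, Measurable fun ω => vnorm (D.z n t ω) := fun n t => by
    unfold vnorm
    exact Measurable.sqrt (Finset.measurable_sum _ fun j _ =>
      ((measurable_pi_apply j).comp (measurable_z hm n t)).mul
        ((measurable_pi_apply j).comp (measurable_z hm n t)))
  have key : ∀ n, ∀ s ∈ Finset.range (D.T n),
      Integrable (fun ω => vnorm (D.z n (s + 1) ω) ^ 4) P ∧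
      ∫ ω, vnorm (D.z n (s + 1) ω) ^ 4 ∂P ≤ 1 + M := fun n s hs => by
    have h := (hM n (s + 1) (by omega) (Finset.mem_range.mp hs)).four_of_eight (hv n (s + 1))
      fun ω => le_rfl
    simpa only [MomentLE, abs_of_nonneg (vnorm_nonneg _)] using h
  refine isBigOp_of_integral_le (M := 1 + M)
    (fun n ω => Finset.sum_nonneg fun s _ => pow_nonneg (vnorm_nonneg _) 4) ?_ ?_
  · filter_upwards [hT.eventually_ge_atTop 1] with n hn
    exact_mod_cast hn
  · refine Eventually.of_forall fun n => ⟨integrable_finsetSum _ fun s hs => (key n s hs).1, ?_⟩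
    rw [integral_finsetSum _ fun s hs => (key n s hs).1]
    refine (Finset.sum_le_card_nsmul _ _ _ fun s hs => (key n s hs).2).trans (le_of_eq ?_)
    rw [Finset.card_range, nsmul_eq_mul, mul_comm]

theorem measurable_noise (hm : D.IsMeasurable) (a : Fin r → ℝ) (n t : ℕ) (j : Fin r) :
    Measurable fun ω => D.noise a n t ω j := by
  have h : Measurable fun ω => (D.N n : ℝ) ^ (-(a j / 2)) *
      ∑ i, D.lam n ω i j * D.e n t ω i :=
    (Finset.measurable_sum _ fun i _ =>
      (hm.lam n i j).mul ((measurable_pi_apply i).comp (hm.e n t))).const_mul _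
  have e : (fun ω => D.noise a n t ω j) = fun ω => (D.N n : ℝ) ^ (-(a j / 2)) *
      ∑ i, D.lam n ω i j * D.e n t ω i := by
    funext ω
    rw [noise, Binv_mulVec_apply]
    rfl
  rw [e]
  exact h

theorem exists_moment_noise (hm : D.IsMeasurable) {a : Fin r → ℝ} {m : ℝ}
    {SL : Matrix (Fin r) (Fin r) ℝ} (hL : D.HetLoadings P a m SL) :
    ∃ M, ∀ n t, 1 ≤ t → t ≤ D.T n → ∀ j, MomentLE P (fun ω => D.noise a n t ω j) 4 M := by
  obtain ⟨M, hM⟩ := hL.moment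
  exact ⟨1 + M, fun n t h1 h2 j => (hM n t h1 h2).four_of_eight
    (measurable_noise hm a n t j) fun ω =>
      (abs_apply_le_vnorm _ j).trans (le_abs_self _)⟩

/-- The sum is the squared Frobenius norm of the matrix of normalized noises, hence bounds its
operator norm. -/
theorem isBigOp_sum_noise (hm : D.IsMeasurable) {a : Fin r → ℝ} {m : ℝ}
    {SL : Matrix (Fin r) (Fin r) ℝ} (hL : D.HetLoadings P a m SL)
    (hT : Tendsto D.T atTop atTop) :
    IsBigOp P (fun n ω => ∑ s ∈ Finset.range (D.T n), vnorm (D.noise a n (s + 1) ω) ^ 2)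
      (fun n => D.T n) := by
  obtain ⟨M, hM⟩ := exists_moment_noise hm hL
  -- Pairing with the constant `1` turns the product bound into a second moment bound.
  have h1 : MomentLE P (fun _ : Ω => (1 : ℝ)) 4 1 := ⟨by simp, by simp⟩
  have key : ∀ n, ∀ s ∈ Finset.range (D.T n), ∀ j,
      Integrable (fun ω => D.noise a n (s + 1) ω j ^ 2) P ∧
      ∫ ω, D.noise a n (s + 1) ω j ^ 2 ∂P ≤ M + 1 := fun n s hs j => by
    have h := (hM n (s + 1) (by omega) (Finset.mem_range.mp hs) j).memLp_mul h1
      (measurable_noise hm a n (s + 1) j) measurable_const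
    simp only [mul_one] at h
    exact ⟨h.1.integrable_sq, h.2⟩
  simp_rw [vnorm_sq_eq_sum]
  refine isBigOp_of_integral_le (M := r * (M + 1))
    (fun n ω => Finset.sum_nonneg fun s _ => Finset.sum_nonneg fun j _ => sq_nonneg _) ?_ ?_
  · filter_upwards [hT.eventually_ge_atTop 1] with n hn
    exact_mod_cast hn
  · refine Eventually.of_forall fun n => ?_
    have hi : ∀ s ∈ Finset.range (D.T n),
        Integrable (fun ω => ∑ j, D.noise a n (s + 1) ω j ^ 2) P := fun s hs =>
      integrable_finsetSum _ fun j _ => (key n s hs j).1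
    refine ⟨integrable_finsetSum _ hi, ?_⟩
    rw [integral_finsetSum _ hi]
    refine (Finset.sum_le_card_nsmul _ _ (r * (M + 1)) fun s hs => ?_).trans (le_of_eq ?_)
    · rw [integral_finsetSum _ fun j _ => (key n s hs j).1]
      refine (Finset.sum_le_card_nsmul _ _ _ fun j _ => (key n s hs j).2).trans (le_of_eq ?_)
      rw [Finset.card_univ, Fintype.card_fin, nsmul_eq_mul]
    · rw [Finset.card_range, nsmul_eq_mul, mul_comm]

end Panel

end FactorForecast

namespace FactorForecast

/-! ### Bounds for the design matrices and the loadings. -/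

section Design

variable {κ : Type*} [Fintype κ]

theorem vnorm_of_mulVec_sq (z : ℕ → κ → ℝ) (m : ℕ) (v : κ → ℝ) :
    vnorm ((Matrix.of fun s : Fin m => z (s + 1)) *ᵥ v) ^ 2 =
      ∑ s ∈ Finset.range m, (z (s + 1) ⬝ᵥ v) ^ 2 := by
  rw [vnorm_sq_eq_sum, Finset.sum_range]
  rfl

theorem transpose_of_mulVec {κ : Type*} (x : ℕ → κ → ℝ) (u : ℕ → ℝ) (m : ℕ) :
    (Matrix.of fun s : Fin m => x s)ᵀ *ᵥ (fun s : Fin m => u s) =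
      ∑ s ∈ Finset.range m, u s • x s := by
  ext i
  simp [Matrix.mulVec, dotProduct, Finset.sum_range, mul_comm]

theorem sum_dotProduct_sq (z : ℕ → κ → ℝ) (S : Matrix κ κ ℝ) (t : ℕ) {c : ℝ} (hc : c ≠ 0)
    (v : κ → ℝ) :
    ∑ s ∈ Finset.range t, (z (s + 1) ⬝ᵥ v) ^ 2 = t * (v ⬝ᵥ S *ᵥ v) +
      c * (v ⬝ᵥ (c⁻¹ • ∑ s ∈ Finset.Icc 1 t, (vecMulVec (z s) (z s) - S)) *ᵥ v) := by
  have h1 : ∀ s, v ⬝ᵥ (vecMulVec (z s) (z s) - S) *ᵥ v = (z s ⬝ᵥ v) ^ 2 - v ⬝ᵥ S *ᵥ v := by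
    intro s
    rw [sub_mulVec, dotProduct_sub, vecMulVec_mulVec]
    simp only [op_smul_eq_smul, dotProduct_smul, smul_eq_mul, dotProduct_comm v (z s), sq]
  rw [smul_mulVec, dotProduct_smul, smul_eq_mul, mul_inv_cancel_left₀ hc, sum_mulVec,
    dotProduct_sum]
  simp_rw [h1]
  rw [Finset.sum_sub_distrib, Finset.sum_const, Nat.card_Icc, nsmul_eq_mul, Nat.add_sub_cancel,
    Finset.range_eq_Ico, Finset.sum_Ico_add' (fun s => (z s ⬝ᵥ v) ^ 2) 0 t 1]
  have : Finset.Ico (0 + 1) (t + 1) = Finset.Icc 1 t := by ext s; simp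
  rw [this]
  ring

/-- Two-sided bounds for the design matrices with `t` and `t - 1` rows. -/
theorem design_bounds (z : ℕ → κ → ℝ) (S : Matrix κ κ ℝ) {t m : ℕ} {Q C c p : ℝ}
    (hS : ∀ v, c * vnorm v ^ 2 ≤ v ⬝ᵥ S *ᵥ v) (hc : 0 < c) (hC : 1 ≤ C) (hQ : 1 ≤ Q)
    (hΔ : frob ((Q ^ 4)⁻¹ • ∑ s ∈ Finset.Icc 1 t, (vecMulVec (z s) (z s) - S)) ≤ C * (Q ^ 2)⁻¹)
    (hz : vnorm (z t) ^ 2 ≤ C * Q ^ 2) (ht : 1 ≤ t) (htQ : (t : ℝ) ≤ Q ^ 4)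
    (hpt : p / 2 * Q ^ 4 ≤ t) (hQl : 8 * C ≤ p * c * Q ^ 2) (hm : m = t ∨ m = t - 1)
    (v : κ → ℝ) :
    p * c / 4 * (Q ^ 4 * vnorm v ^ 2) ≤
        vnorm ((Matrix.of fun s : Fin m => z (s + 1)) *ᵥ v) ^ 2 ∧
      vnorm ((Matrix.of fun s : Fin m => z (s + 1)) *ᵥ v) ^ 2 ≤
        (frob S + C) * (Q ^ 4 * vnorm v ^ 2) := by
  have hQ4 : (0 : ℝ) < Q ^ 4 := by positivity
  have hv := sq_nonneg (vnorm v)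
  have h0 := sum_dotProduct_sq z S t hQ4.ne' v
  have hd := abs_dotProduct_mulVec_le ((OpLE.frob _).mono hΔ) v
  have hS' := (le_abs_self _).trans (abs_dotProduct_mulVec_le (OpLE.frob S) v)
  set Δ := v ⬝ᵥ ((Q ^ 4)⁻¹ • ∑ s ∈ Finset.Icc 1 t, (vecMulVec (z s) (z s) - S)) *ᵥ v
  have hd' : |Q ^ 4 * Δ| ≤ C * Q ^ 2 * vnorm v ^ 2 := by
    rw [abs_mul, abs_of_pos hQ4]
    refine (mul_le_mul_of_nonneg_left hd hQ4.le).trans (le_of_eq ?_)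
    field_simp
  obtain ⟨hd1, hd2⟩ := abs_le.mp hd'
  have hQQ : Q ^ 2 ≤ Q ^ 4 := pow_le_pow_right₀ hQ (by norm_num)
  have hup : ∑ s ∈ Finset.range t, (z (s + 1) ⬝ᵥ v) ^ 2 ≤
      (frob S + C) * (Q ^ 4 * vnorm v ^ 2) := by
    rw [h0]
    have h1 : t * (v ⬝ᵥ S *ᵥ v) ≤ Q ^ 4 * (frob S * vnorm v ^ 2) :=
      mul_le_mul htQ hS' ((mul_nonneg hc.le hv).trans (hS v)) hQ4.le
    have h2 : C * Q ^ 2 * vnorm v ^ 2 ≤ C * Q ^ 4 * vnorm v ^ 2 := by gcongr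
    linarith
  have hlow : t * (c * vnorm v ^ 2) - C * Q ^ 2 * vnorm v ^ 2 ≤
      ∑ s ∈ Finset.range t, (z (s + 1) ⬝ᵥ v) ^ 2 := by
    rw [h0]
    have := mul_le_mul_of_nonneg_left (hS v) (Nat.cast_nonneg (α := ℝ) t)
    linarith
  -- One `C Q²` is the deviation in the law of large numbers, the other pays for a missing last row;
  -- `8 C ≤ p c Q²` lets half of the main term absorb both.
  have hlow' : p * c / 4 * (Q ^ 4 * vnorm v ^ 2) ≤
      t * (c * vnorm v ^ 2) - C * Q ^ 2 * vnorm v ^ 2 - C * Q ^ 2 * vnorm v ^ 2 := by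
    have h1 : p / 2 * Q ^ 4 * (c * vnorm v ^ 2) ≤ t * (c * vnorm v ^ 2) :=
      mul_le_mul_of_nonneg_right hpt (mul_nonneg hc.le hv)
    have h2 : 8 * C * (Q ^ 2 * vnorm v ^ 2) ≤ p * c * Q ^ 2 * (Q ^ 2 * vnorm v ^ 2) :=
      mul_le_mul_of_nonneg_right hQl (by positivity)
    have e : p * c * Q ^ 2 * (Q ^ 2 * vnorm v ^ 2) = p * c * (Q ^ 4 * vnorm v ^ 2) := by ring
    rw [e] at h2
    linarith
  have hCQ : 0 ≤ C * Q ^ 2 * vnorm v ^ 2 := by positivity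
  rw [vnorm_of_mulVec_sq]
  rcases hm with rfl | rfl
  · exact ⟨by linarith, hup⟩
  · obtain ⟨q, rfl⟩ : ∃ q, t = q + 1 := ⟨t - 1, by omega⟩
    rw [Nat.add_sub_cancel]
    rw [Finset.sum_range_succ] at hup hlow
    have h1 : (z (q + 1) ⬝ᵥ v) ^ 2 ≤ C * Q ^ 2 * vnorm v ^ 2 := by
      have h2 := pow_le_pow_left₀ (abs_nonneg _) (abs_dotProduct_le (z (q + 1)) v) 2
      rw [sq_abs, mul_pow] at h2
      exact h2.trans (mul_le_mul_of_nonneg_right hz hv)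
    exact ⟨by linarith, by nlinarith [sq_nonneg (z (q + 1) ⬝ᵥ v)]⟩

/-- Square roots of constants are avoided through `1 / c ≤ C ≤ C²`. -/
theorem le_mul_of_mul_sq_le {x y c C : ℝ} (hc : 0 < c) (hC : 1 ≤ C) (hcC : 1 / c ≤ C)
    (hy : 0 ≤ y) (h : c * x ^ 2 ≤ y ^ 2) : x ≤ C * y := by
  apply le_of_sq_le_sq _ (by positivity)
  have h1 : x ^ 2 ≤ 1 / c * y ^ 2 := by
    rw [one_div, inv_mul_eq_div, le_div_iff₀ hc]; linarith
  have h2 : 1 / c ≤ C ^ 2 := hcC.trans (le_self_pow₀ hC (by norm_num))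
  rw [mul_pow]
  exact h1.trans (mul_le_mul_of_nonneg_right h2 (sq_nonneg y))

/-- In the coordinates `w = B_N v` the quadratic form of `LᵀL` is close to that of `SL`, hence at
least `c / 2`. Returning to `v` costs the largest entry of `d`, that is, the weakest strength. -/
theorem loading_lower_bound {N r : ℕ} {L : Matrix (Fin N) (Fin r) ℝ} {d : Fin r → ℝ}
    {SL : Matrix (Fin r) (Fin r) ℝ} {b c C C₀ : ℝ} (hd : ∀ j, 0 < d j) (hb : 0 < b)
    (hdb : ∀ j, d j ≤ b⁻¹) (hSL : ∀ v, c * vnorm v ^ 2 ≤ v ⬝ᵥ SL *ᵥ v) (hc : 0 < c)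
    (hf : frob (Matrix.diagonal d * (Lᵀ * L) * Matrix.diagonal d - SL) ≤ C₀)
    (hC₀ : C₀ ≤ c / 2) (hC : 1 ≤ C) (hcC : 2 / c ≤ C) (v : Fin r → ℝ) :
    b * vnorm v ≤ C * vnorm (L *ᵥ v) := by
  set w : Fin r → ℝ := fun j => v j / d j with hw
  have hwv : Matrix.diagonal d *ᵥ w = v := by
    ext j
    rw [mulVec_diagonal, hw]
    exact mul_div_cancel₀ _ (hd j).ne'
  have h1 : w ⬝ᵥ (Matrix.diagonal d * (Lᵀ * L) * Matrix.diagonal d) *ᵥ w =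
      vnorm (L *ᵥ v) ^ 2 := by
    rw [Matrix.mul_assoc, ← mulVec_mulVec, ← mulVec_mulVec, hwv, dotProduct_mulVec,
      ← mulVec_transpose, diagonal_transpose, hwv, dotProduct_mulVec_self]
  have h2 := (abs_le.mp (abs_dotProduct_mulVec_le ((OpLE.frob _).mono (hf.trans hC₀)) w)).1
  rw [sub_mulVec, dotProduct_sub, h1] at h2
  have h3 : c / 2 * vnorm w ^ 2 ≤ vnorm (L *ᵥ v) ^ 2 := by linarith [hSL w]
  have h4 : b * vnorm v ≤ vnorm w := by
    have := OpLE.diagonal (d := d) (C := b⁻¹) (by positivity)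
      (fun j => by rw [abs_of_pos (hd j)]; exact hdb j) w
    rw [hwv, inv_mul_eq_div, le_div_iff₀ hb] at this
    linarith
  exact h4.trans (le_mul_of_mul_sq_le (by positivity) hC (by rw [one_div_div]; exact hcC)
    (vnorm_nonneg _) h3)

theorem vnorm_le_of_sq_le {κ : Type*} [Fintype κ] {v : κ → ℝ} {x C c : ℝ} (hx : 0 ≤ x)
    (hC : 1 ≤ C) (hcC : c ≤ C) (h : vnorm v ^ 2 ≤ c * x ^ 2) : vnorm v ≤ C * x := by
  apply le_of_sq_le_sq _ (by positivity)
  rw [mul_pow]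
  exact h.trans (mul_le_mul_of_nonneg_right (hcC.trans (le_self_pow₀ hC (by norm_num)))
    (sq_nonneg x))

end Design

/-! ### The deterministic bound applied to one outcome. -/

namespace Panel

variable {Ω : Type*} {k r : ℕ} {D : Panel Ω k r}

theorem X_eq (n t : ℕ) (ω : Ω) : D.X n t ω = D.F n t ω * (D.lam n ω)ᵀ + D.E n t ω := by
  ext s i
  simp [X, F, E, x, Matrix.mul_apply, Matrix.mulVec, dotProduct, mul_comm]

theorem E_mul_lam (a : Fin r → ℝ) (hB : ∀ n j, 0 < D.N n → (D.N n : ℝ) ^ (-(a j / 2)) ≠ 0)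
    {n : ℕ} (hN : 0 < D.N n) (t : ℕ) (ω : Ω) :
    D.E n t ω * D.lam n ω = (Matrix.of fun s : Fin t => D.noise a n (s + 1) ω) *
      Matrix.diagonal fun j => ((D.N n : ℝ) ^ (-(a j / 2)))⁻¹ := by
  ext s j
  rw [mul_diagonal, of_apply, noise, Binv_mulVec_apply, mul_comm, inv_mul_cancel_left₀ (hB n j hN)]
  simp [E, Matrix.mul_apply, Matrix.mulVec, dotProduct, mul_comm]

set_option maxHeartbeats 1000000 in
/-- Bound for the gap at one date and one outcome. -/
theorem gap_le {θ : Fin k → ℝ} {β0 : Fin r → ℝ} (hmod : D.IsModel θ β0) {n t : ℕ} {ω : Ω}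
    {Sz : Matrix (Fin k ⊕ Fin r) (Fin k ⊕ Fin r) ℝ} {SL : Matrix (Fin r) (Fin r) ℝ}
    {a : Fin r → ℝ} {Fh : Matrix (Fin t) (Fin r) ℝ} (hFh : IsPCFactors (D.X n t ω) Fh)
    {Q A b ρ C C₀ p cz cL : ℝ} (hrt : r ≤ t) (ht1 : 1 ≤ t) (htT : t ≤ D.T n - 1)
    (hT : (D.T n : ℝ) = Q ^ 4) (hT' : (D.T n : ℝ) ^ (-(1 / 4) : ℝ) = Q⁻¹)
    (hN : (D.N n : ℝ) = A ^ 2) (hQ : 1 ≤ Q) (hA : 1 ≤ A) (hb : 0 < b)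
    (hdb : ∀ j, (D.N n : ℝ) ^ (-(a j / 2)) ≤ b⁻¹) (hdA : ∀ j, A⁻¹ ≤ (D.N n : ℝ) ^ (-(a j / 2)))
    (hSz : ∀ v, cz * vnorm v ^ 2 ≤ v ⬝ᵥ Sz *ᵥ v) (hcz : 0 < cz)
    (hSL : ∀ v, cL * vnorm v ^ 2 ≤ v ⬝ᵥ SL *ᵥ v) (hcL : 0 < cL) (hp : 0 < p)
    (hpt : p / 2 * Q ^ 4 ≤ t) (hC₀ : 1 ≤ C₀)
    (hlln : frob ((Q ^ 4)⁻¹ • ∑ s ∈ Finset.Icc 1 t,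
      (vecMulVec (D.z n s ω) (D.z n s ω) - Sz)) ≤ C₀ * (Q ^ 2)⁻¹)
    (hsp : spNorm (D.E n t ω) ≤ C₀ * (A + Q ^ 2))
    (hload : frob (D.Binv a n * ((D.lam n ω)ᵀ * D.lam n ω) * D.Binv a n - SL) ≤ C₀ * b⁻¹)
    (hz4 : ∑ s ∈ Finset.range (D.T n), vnorm (D.z n (s + 1) ω) ^ 4 ≤ C₀ * Q ^ 4)
    (hnoise : ∑ s ∈ Finset.range (D.T n), vnorm (D.noise a n (s + 1) ω) ^ 2 ≤ C₀ * Q ^ 4)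
    (hzu : vnorm (∑ s ∈ Finset.range (t - 1), D.u n (s + 2) ω • D.z n (s + 1) ω) ^ 2 ≤
      C₀ * (k + r) * (Q ^ 3) ^ 2)
    (hnu : vnorm (∑ s ∈ Finset.range (t - 1), D.u n (s + 2) ω • D.noise a n (s + 1) ω) ^ 2 ≤
      C₀ * r * (Q ^ 3) ^ 2)
    (heu : vnorm (∑ s ∈ Finset.range (t - 1), D.u n (s + 2) ω • D.e n (s + 1) ω) ^ 2 ≤
      C₀ * (A * Q ^ 3) ^ 2)
    (hQl : 8 * C₀ ≤ p * cz * Q ^ 2) (hbl : C₀ * b⁻¹ ≤ cL / 2)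
    (hC : C₀ * (k + r + 1) + 4 / (p * cz) + frob Sz + 2 / cL + 2 / p + vnorm β0 ≤ C)
    (hρ : ρ = A / b ^ 2 + A ^ 2 / (b ^ 2 * Q ^ 2)) (hρs : 64 * C ^ 9 * ρ ≤ 1)
    (hsmall : 2 * C ^ 3 * (A + Q ^ 2) ≤ b * Q ^ 2) :
    Q * vnorm (D.deltaHat n t Fh ω - ((D.Phi n t Fh ω)⁻¹)ᵀ *ᵥ D.deltaTilde n t ω) ≤
      2500 * C ^ 18 * ρ := by
  have hC₀0 : 0 < C₀ := by linarith
  have hQ0 : 0 < Q := by linarith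
  have hA0 : 0 < A := by linarith
  have hk0 : (0 : ℝ) ≤ k := Nat.cast_nonneg k
  have hr0 : (0 : ℝ) ≤ r := Nat.cast_nonneg r
  have hCkr : 0 ≤ C₀ * (k + r) := by positivity
  have hCk : 0 ≤ C₀ * k := by positivity
  have hCr : 0 ≤ C₀ * r := by positivity
  have p1 : 0 < 4 / (p * cz) := by positivity
  have p2 : 0 < 2 / cL := by positivity
  have p3 : 0 < 2 / p := by positivity
  have p4 := frob_nonneg Sz
  have p5 := vnorm_nonneg β0
  have hC0le : C₀ ≤ C := by linarith
  have hC1 : 1 ≤ C := hC₀.trans hC0le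
  have hC0 : 0 < C := by linarith
  have hCC : C ≤ C ^ 2 := le_self_pow₀ hC1 (by norm_num)
  have hNpos : 0 < D.N n := by
    have : (0 : ℝ) < D.N n := by rw [hN]; positivity
    exact_mod_cast this
  have htT' : t < D.T n := by omega
  have htQ : (t : ℝ) ≤ Q ^ 4 := by rw [← hT]; exact_mod_cast htT'.le
  have hd0 : ∀ j, 0 < (D.N n : ℝ) ^ (-(a j / 2)) := fun j =>
    Real.rpow_pos_of_pos (by exact_mod_cast hNpos) _
  -- the predictors
  have hzt : vnorm (D.z n t ω) ^ 2 ≤ C₀ * Q ^ 2 := by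
    have h1 : vnorm (D.z n (t - 1 + 1) ω) ^ 4 ≤ C₀ * Q ^ 4 :=
      (Finset.single_le_sum (f := fun s => vnorm (D.z n (s + 1) ω) ^ 4)
        (fun s _ => pow_nonneg (vnorm_nonneg _) 4)
        (Finset.mem_range.mpr (by omega : t - 1 < D.T n))).trans hz4
    rw [Nat.sub_add_cancel ht1] at h1
    apply le_of_sq_le_sq _ (by positivity)
    calc (vnorm (D.z n t ω) ^ 2) ^ 2 = vnorm (D.z n t ω) ^ 4 := by ring
      _ ≤ C₀ * Q ^ 4 := h1
      _ ≤ C₀ ^ 2 * Q ^ 4 := by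
        gcongr
        exact le_self_pow₀ hC₀ (by norm_num)
      _ = (C₀ * Q ^ 2) ^ 2 := by ring
  have hdes := fun m hm v => design_bounds (fun s => D.z n s ω) Sz (m := m) hSz hcz hC₀ hQ hlln
    hzt ht1 htQ hpt hQl hm v
  have hpc : 1 / (p * cz / 4) ≤ C := by rw [one_div_div]; linarith
  have hlow : ∀ m, m = t ∨ m = t - 1 → ∀ v, Q ^ 2 * vnorm v ≤
      C * vnorm ((Matrix.of fun s : Fin m => D.z n (s + 1) ω) *ᵥ v) := fun m hm v => by
    refine le_mul_of_mul_sq_le (c := p * cz / 4) (by positivity) hC1 hpc (vnorm_nonneg _) ?_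
    refine le_trans (le_of_eq ?_) (hdes m hm v).1
    ring
  have hup : ∀ m, m = t ∨ m = t - 1 →
      OpLE (Matrix.of fun s : Fin m => D.z n (s + 1) ω) (C * Q ^ 2) := fun m hm v => by
    have := vnorm_le_of_sq_le (x := Q ^ 2 * vnorm v) (C := C) (c := frob Sz + C₀)
      (mul_nonneg (by positivity) (vnorm_nonneg v)) hC1 (by linarith)
      ((hdes m hm v).2.trans (le_of_eq (by ring)))
    rwa [← mul_assoc] at this
  have hFz : ∀ v, D.F n t ω *ᵥ v =
      (Matrix.of fun s : Fin t => D.z n (s + 1) ω) *ᵥ Sum.elim (0 : Fin k → ℝ) v := fun v => by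
    ext s
    simp [F, z, Matrix.mulVec, dotProduct]
  have hel : ∀ v : Fin r → ℝ, vnorm (Sum.elim (0 : Fin k → ℝ) v) = vnorm v := fun v => by
    apply (pow_left_inj₀ (vnorm_nonneg _) (vnorm_nonneg _) two_ne_zero).mp
    rw [vnorm_sumElim_sq]; simp
  let W : Matrix (Fin (t - 1)) (Fin k) ℝ := Matrix.of fun s => D.w n (s + 1) ω
  have hZ : fromCols W ((D.F n t ω).submatrix (Fin.castLE (Nat.sub_le t 1)) id) =
      Matrix.of fun s : Fin (t - 1) => D.z n (s + 1) ω := by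
    ext s (j | j) <;> rfl
  -- the noise
  have hEL := E_mul_lam (D := D) a (fun n j hn =>
    (Real.rpow_pos_of_pos (by exact_mod_cast hn) _).ne') hNpos t ω
  -- All strengths are at most `1`, so `B_N` has norm at most `√N = A`. Using this bound for every
  -- strength yields the term `N^{1/2-α}` of the rate.
  have hBop : OpLE (Matrix.diagonal fun j => ((D.N n : ℝ) ^ (-(a j / 2)))⁻¹) A := by
    refine OpLE.diagonal hA0.le fun j => ?_
    rw [abs_of_pos (inv_pos.mpr (hd0 j))]
    exact inv_le_of_inv_le₀ hA0 (hdA j)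
  have hnop : OpLE (Matrix.of fun s : Fin t => D.noise a n (s + 1) ω) (C * Q ^ 2) := by
    refine (OpLE.frob _).mono ?_
    apply le_of_sq_le_sq _ (by positivity)
    have h1 : frob (Matrix.of fun s : Fin t => D.noise a n (s + 1) ω) ^ 2 =
        ∑ s ∈ Finset.range t, vnorm (D.noise a n (s + 1) ω) ^ 2 := by
      rw [frob_sq, Finset.sum_range]
      simp only [vnorm_sq_eq_sum, of_apply]
    rw [h1]
    refine (Finset.sum_le_sum_of_subset_of_nonneg (Finset.range_subset_range.mpr htT'.le)
      fun s _ _ => sq_nonneg _).trans (hnoise.trans ?_)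
    rw [mul_pow, ← pow_mul]
    exact mul_le_mul_of_nonneg_right (hC0le.trans hCC) (by positivity)
  let u : Fin (t - 1) → ℝ := fun s => D.u n (s + 2) ω
  have hzu' := vnorm_le_of_sq_le (C := C) (by positivity) hC1 (by linarith) hzu
  have hnu' := vnorm_le_of_sq_le (C := C) (by positivity) hC1 (by linarith) hnu
  have heu' := vnorm_le_of_sq_le (C := C) (by positivity) hC1 hC0le heu
  have hsumz : (Matrix.of fun s : Fin (t - 1) => D.z n (s + 1) ω)ᵀ *ᵥ u =
      ∑ s ∈ Finset.range (t - 1), D.u n (s + 2) ω • D.z n (s + 1) ω :=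
    transpose_of_mulVec (fun s => D.z n (s + 1) ω) (fun s => D.u n (s + 2) ω) (t - 1)
  refine vnorm_gap_le (k := k) (r := r) W
    (Sum.elim θ (((D.T n : ℝ) ^ (-(1 / 4) : ℝ)) • β0)) u
    (fun s => D.y n (s + 2) ω) (X := D.X n t ω) (F := D.F n t ω) (E := D.E n t ω)
    (L := D.lam n ω) (X_eq n t ω) hFh hrt hQ hA hb hC1 hN htQ ?_ ?_ ?_ ?_ ?_ ?_ ?_ ?_ ?_ ?_ ?_ ?_
    ?_ ?_ hρ hρs hsmall
  · have h1 : 2 / p ≤ C ^ 2 := by linarith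
    have h2 := mul_le_mul_of_nonneg_right h1 (Nat.cast_nonneg (α := ℝ) t)
    refine le_trans ?_ h2
    rw [div_mul_eq_mul_div, le_div_iff₀ hp]
    linarith
  · rw [hZ]
    ext s
    rw [hmod n (s + 1) (by omega) (by omega) ω]
    simp [u, z, Matrix.mulVec, dotProduct, mul_comm]
  · exact loading_lower_bound hd0 hb hdb hSL hcL hload hbl hC1 (by linarith)
  · intro v
    rw [hFz, ← hel v]
    exact hlow t (Or.inl rfl) _
  · rw [hZ]
    exact hlow _ (Or.inr rfl)
  · intro v
    rw [hFz, ← hel v]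
    exact hup t (Or.inl rfl) _
  · rw [hZ]
    exact hup _ (Or.inr rfl)
  · exact (OpLE.spNorm _).mono (hsp.trans (mul_le_mul_of_nonneg_right hC0le (by positivity)))
  · rw [hEL]
    exact (hnop.mul (by positivity) hBop).mono (le_of_eq (by ring))
  · simp only [Sum.elim_inr]
    have : (fun j => (((D.T n : ℝ) ^ (-(1 / 4) : ℝ)) • β0) j) = Q⁻¹ • β0 := by rw [hT']
    rw [this, vnorm_smul, abs_of_pos (by positivity), inv_mul_eq_div]
    gcongr
    linarith
  · rw [hZ, hsumz]
    exact hzu'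
  -- The factor score is a block of the full score.
  · refine le_trans (le_trans (le_of_eq ?_) (vnorm_inr_le
      (∑ s ∈ Finset.range (t - 1), D.u n (s + 2) ω • D.z n (s + 1) ω))) hzu'
    rw [← hsumz]
    rfl
  · have h1 : (D.E n t ω * D.lam n ω).submatrix (Fin.castLE (Nat.sub_le t 1)) id =
        (Matrix.of fun s : Fin (t - 1) => D.noise a n (s + 1) ω) *
          Matrix.diagonal fun j => ((D.N n : ℝ) ^ (-(a j / 2)))⁻¹ := by
      rw [hEL]
      rfl
    have h2 : (Matrix.of fun s : Fin (t - 1) => D.noise a n (s + 1) ω)ᵀ *ᵥ u =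
        ∑ s ∈ Finset.range (t - 1), D.u n (s + 2) ω • D.noise a n (s + 1) ω :=
      transpose_of_mulVec (fun s => D.noise a n (s + 1) ω) (fun s => D.u n (s + 2) ω) (t - 1)
    rw [h1, transpose_mul, ← mulVec_mulVec, h2, diagonal_transpose]
    refine (hBop _).trans ((mul_le_mul_of_nonneg_left hnu' hA0.le).trans (le_of_eq ?_))
    ring
  · have h2 : ((D.E n t ω).submatrix (Fin.castLE (Nat.sub_le t 1)) id)ᵀ *ᵥ u =
        ∑ s ∈ Finset.range (t - 1), D.u n (s + 2) ω • D.e n (s + 1) ω :=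
      transpose_of_mulVec (fun s => D.e n (s + 1) ω) (fun s => D.u n (s + 2) ω) (t - 1)
    rw [h2]
    exact heu'

end Panel

end FactorForecast

namespace FactorForecast

/-! ### Comparison of rates. -/

namespace Panel

/-- `N^{1/2-α} + N^{1-α} T^{-1/2}`. -/
noncomputable def sqrtRate {Ω : Type*} {k r : ℕ} (D : Panel Ω k r) (α : ℝ) (n : ℕ) : ℝ :=
  (D.N n : ℝ) ^ (1 / 2 - α) + (D.N n : ℝ) ^ (1 - α) / √(D.T n)

section Rates

variable {Ω : Type*} {k r : ℕ} {D : Panel Ω k r} {α : ℝ}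

theorem sqrtRate_nonneg (n : ℕ) : 0 ≤ D.sqrtRate α n := by
  unfold sqrtRate; positivity

theorem Expansion.tendsto_rpow_neg (hD : D.Expansion α) {c : ℝ} (hc : 0 < c) :
    Tendsto (fun n => (D.N n : ℝ) ^ (-c)) atTop (𝓝 0) :=
  (tendsto_rpow_neg_atTop hc).comp (tendsto_natCast_atTop_atTop.comp hD.N)

theorem Expansion.tendsto_sqrtRate (hD : D.Expansion α) (hα : 1 / 2 < α) :
    Tendsto (D.sqrtRate α) atTop (𝓝 0) := by
  have h1 := hD.tendsto_rpow_neg (c := α - 1 / 2) (by linarith)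
  simp only [neg_sub] at h1
  have h2 := h1.add hD.rate
  rwa [add_zero] at h2

/-- By `(x + y)² ≤ 2x² + 2y²` and `k₀ ≤ T`; the summand `T^{-1/2}` of `gapRate` is pure slack. -/
theorem sqrtRate_sq_le {π₀ : ℝ} (hπ₀ : π₀ ≤ 1) {n : ℕ} (hN : 0 < D.N n)
    (hk : 0 < D.k0 π₀ n) : D.sqrtRate α n ^ 2 ≤ 2 * D.gapRate π₀ α n := by
  have hN' : (0 : ℝ) < D.N n := by exact_mod_cast hN
  have hk' : (0 : ℝ) < D.k0 π₀ n := by exact_mod_cast hk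
  have hkT : (D.k0 π₀ n : ℝ) ≤ D.T n := by
    refine (Nat.floor_le_of_le ?_ |> Nat.cast_le.mpr)
    nlinarith [Nat.cast_nonneg (α := ℝ) (D.T n)]
  have h1 : ((D.N n : ℝ) ^ (1 / 2 - α)) ^ 2 = (D.N n : ℝ) ^ (1 - 2 * α) := by
    rw [← Real.rpow_natCast, ← Real.rpow_mul hN'.le]
    congr 1; push_cast; ring
  have h2 : ((D.N n : ℝ) ^ (1 - α)) ^ 2 = (D.N n : ℝ) ^ (2 - 2 * α) := by
    rw [← Real.rpow_natCast, ← Real.rpow_mul hN'.le]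
    congr 1; push_cast; ring
  have h3 : ((D.N n : ℝ) ^ (1 - α) / √(D.T n)) ^ 2 ≤
      (D.N n : ℝ) ^ (2 - 2 * α) / (D.k0 π₀ n : ℝ) := by
    rw [div_pow, h2, Real.sq_sqrt (Nat.cast_nonneg _)]
    gcongr
  have h4 : (0 : ℝ) ≤ (D.T n : ℝ) ^ (-(1 / 2) : ℝ) := by positivity
  unfold sqrtRate gapRate
  nlinarith [sq_nonneg ((D.N n : ℝ) ^ (1 / 2 - α) - (D.N n : ℝ) ^ (1 - α) / √(D.T n))]

/-- Rounding down loses less than one period, which half of `π₀ T` absorbs once `T ≥ 2 / π₀`. -/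
theorem eventually_le_of_k0_le {π₀ : ℝ} (hπ₀ : 0 < π₀) (hT : Tendsto D.T atTop atTop) :
    ∀ᶠ n in atTop, ∀ t, D.k0 π₀ n ≤ t → π₀ / 2 * D.T n ≤ t := by
  have h := (tendsto_natCast_atTop_atTop.comp hT).eventually_ge_atTop (2 / π₀)
  filter_upwards [h] with n hn t ht
  simp only [Function.comp_apply] at hn
  rw [div_le_iff₀ hπ₀] at hn
  have h1 := Nat.lt_floor_add_one ((D.T n : ℝ) * π₀)
  have h2 : (⌊(D.T n : ℝ) * π₀⌋₊ : ℝ) ≤ t := by exact_mod_cast ht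
  linarith

end Rates

/-! ### From the event of simultaneous bounds to the stochastic order of the gap. -/

variable {Ω : Type*} [MeasurableSpace Ω] {P : Measure Ω} {k r : ℕ}
  {D : Panel Ω k r} {α π₀ : ℝ}

theorem uniformlyClose_of_isBigOp (hD : D.Expansion α) (hα : 1 / 2 < α) (hπ₀ : 0 < π₀)
    (hπ₁ : π₀ ≤ 1) {Fh : (n t : ℕ) → Ω → Matrix (Fin t) (Fin r) ℝ}
    (h : IsBigOp P (D.supGap π₀ Fh) (D.sqrtRate α)) : D.UniformlyClose P π₀ α Fh := by
  refine ⟨h.isLittleOpOne (hD.tendsto_sqrtRate hα), fun ε hε => ?_⟩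
  obtain ⟨C, hC, hn⟩ := h ε hε
  refine ⟨2 * C ^ 2, by positivity, ?_⟩
  filter_upwards [hn, hD.N.eventually_gt_atTop 0, hD.T.eventually_gt_atTop 0,
    eventually_le_of_k0_le hπ₀ hD.T] with n hn hN hT hk
  refine (measure_mono fun ω hω => ?_).trans hn
  rw [Set.mem_ofPred_eq] at hω ⊢
  by_contra! hle
  have hk0 : 0 < D.k0 π₀ n := by
    have h1 := hk _ le_rfl
    have h2 : (0 : ℝ) < D.T n := by exact_mod_cast hT
    have h3 : (0 : ℝ) < D.k0 π₀ n := lt_of_lt_of_le (by positivity) h1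
    exact_mod_cast h3
  have h1 := sqrtRate_sq_le (D := D) (α := α) hπ₁ hN hk0
  have h2 := pow_le_pow_left₀ (abs_nonneg _) hle 2
  rw [mul_pow] at h2
  rw [abs_pow] at hω
  have h3 := mul_le_mul_of_nonneg_left h1 (sq_nonneg C)
  linarith

set_option maxHeartbeats 1000000 in
theorem isBigOp_supGap [IsProbabilityMeasure P] (hr : 0 < r) {θ : Fin k → ℝ} {β0 : Fin r → ℝ} (hπ₀ : 0 < π₀)
    {Sz : Matrix (Fin k ⊕ Fin r) (Fin k ⊕ Fin r) ℝ} (hm : D.IsMeasurable)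
    (hmod : D.IsModel θ β0) (hu : D.ForecastError P) (hz : D.Predictors P π₀ Sz)
    (he : D.Idiosyncratics P π₀) {Fh : (n t : ℕ) → Ω → Matrix (Fin t) (Fin r) ℝ}
    (hFh : ∀ n t ω, D.k0 π₀ n ≤ t → t ≤ D.T n - 1 → r ≤ t →
      IsPCFactors (D.X n t ω) (Fh n t ω))
    {a : Fin r → ℝ} {SL : Matrix (Fin r) (Fin r) ℝ} (hα : 1 / 2 < α) (hα1 : α ≤ 1)
    (ha : ∀ j, α ≤ a j ∧ a j ≤ 1) (hD : D.Expansion α) (hL : D.HetLoadings P a α SL) :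
    IsBigOp P (D.supGap π₀ Fh) (D.sqrtRate α) := by
  obtain ⟨Y1, hY1, hY1'⟩ := exists_isBigOp_sum_z_u hr hm hmod hu hz hD.T
  obtain ⟨M2, hM2⟩ := exists_moment_noise hm hL
  obtain ⟨Y2, hY2, hY2'⟩ := exists_isBigOp_sum_noise_u hm hmod hu hD.T (ι := fun _ => Fin r)
    (Eventually.of_forall fun n => by simpa using hr)
    (fun n L e => D.Binv a n *ᵥ (Lᵀ *ᵥ e)) (fun n i => measurable_noise_fun a n i) hM2
  obtain ⟨M3, hM3⟩ := he.moment
  obtain ⟨Y3, hY3, hY3'⟩ := exists_isBigOp_sum_noise_u hm hmod hu hD.T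
    (ι := fun n => Fin (D.N n)) (by simpa using hD.N.eventually_gt_atTop 0)
    (fun n _ e => e) (fun n i => (measurable_pi_apply i).comp measurable_snd) hM3
  obtain ⟨cz, hcz, hSz⟩ := hz.posDef.exists_le_dotProduct
  obtain ⟨cL, hcL, hSL⟩ := hL.posDef.exists_le_dotProduct
  intro ε hε
  obtain ⟨C₀, hC₀, hev⟩ := exists_forall_isBigOp (P := P) (m := 8)
    (X := ![_, _, _, _, _, Y1, Y2, Y3])
    (c := ![fun n => (D.T n : ℝ) ^ (-(1 / 2) : ℝ), fun n => max √(D.N n) √(D.T n),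
      fun n => (D.N n : ℝ) ^ (-(α / 2)), fun n => D.T n, fun n => D.T n,
      fun n => Fintype.card (Fin k ⊕ Fin r) * (√(D.T n) * D.T n),
      fun n => Fintype.card (Fin r) * (√(D.T n) * D.T n),
      fun n => Fintype.card (Fin (D.N n)) * (√(D.T n) * D.T n)])
    (by
      intro i n
      fin_cases i <;> simp <;> positivity)
    (by
      simp only [Fin.forall_fin_succ]
      exact ⟨hz.lln, he.spectral, hL.limit, isBigOp_sum_z hm hz hD.T,
        isBigOp_sum_noise hm hL hD.T, hY1, hY2, hY3, fun i => i.elim0⟩)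
    hε
  -- The summands serve in turn: score dimensions and the stochastic bounds, lower bound of the
  -- design, its upper bound, lower bound of the loadings, `T` against `t`, and the size of `β⁰`.
  obtain ⟨C, hC⟩ : ∃ C, C = C₀ * (k + r + 1) + 4 / (π₀ * cz) + frob Sz + 2 / cL + 2 / π₀ +
      vnorm β0 := ⟨_, rfl⟩
  have hC1 : 1 ≤ C := by
    have h1 : C₀ ≤ C₀ * (k + r + 1) := le_mul_of_one_le_right (by linarith)
      (by linarith [Nat.cast_nonneg (α := ℝ) k, Nat.cast_nonneg (α := ℝ) r])
    have h2 : 0 < 4 / (π₀ * cz) := by positivity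
    have h3 : 0 < 2 / cL := by positivity
    have h4 : 0 < 2 / π₀ := by positivity
    linarith [frob_nonneg Sz, vnorm_nonneg β0]
  have hC0 : 0 < C := by linarith
  refine ⟨2500 * C ^ 18, by positivity, ?_⟩
  have hsqrtT : Tendsto (fun n => √(D.T n)) atTop atTop :=
    Real.tendsto_sqrt_atTop.comp (tendsto_natCast_atTop_atTop.comp hD.T)
  have hbinv := hD.tendsto_rpow_neg (c := α / 2) (by linarith)
  have hrate := hD.tendsto_sqrtRate hα
  -- The thresholds ensure in turn `r ≤ t`, a design dominated by its mean, loadings dominated by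
  -- their limit, and, with `b = N^{α/2}`, `4 C³ ≤ b` and `64 C⁹ ρ ≤ 1`.
  filter_upwards [hev, hD.N.eventually_ge_atTop 1, hD.T.eventually_ge_atTop 1,
    eventually_le_of_k0_le hπ₀ hD.T,
    (tendsto_natCast_atTop_atTop.comp hD.T).eventually_ge_atTop (2 * r / π₀),
    hsqrtT.eventually_ge_atTop (8 * C₀ / (π₀ * cz)),
    hbinv.eventually_le_const (by positivity : 0 < cL / (2 * C₀)),
    hbinv.eventually_le_const (by positivity : 0 < 1 / (4 * C ^ 3)),
    hrate.eventually_le_const (by positivity : 0 < 1 / (64 * C ^ 9))]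
    with n hn hN1 hT1 hk hTr hTq hbL hbC hρC
  simp only [Function.comp_apply] at hTr
  refine (measure_mono fun ω hω => ?_).trans hn
  rw [Set.mem_ofPred_eq] at hω ⊢
  intro hall
  refine hω.not_ge ?_
  have hNr : (1 : ℝ) ≤ D.N n := by exact_mod_cast hN1
  have hTr1 : (1 : ℝ) ≤ D.T n := by exact_mod_cast hT1
  have hN0 : (0 : ℝ) < D.N n := by linarith
  have hT0 : (0 : ℝ) < D.T n := by linarith
  obtain ⟨Q, hQ⟩ : ∃ Q, Q = (D.T n : ℝ) ^ (1 / 4 : ℝ) := ⟨_, rfl⟩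
  obtain ⟨A, hA⟩ : ∃ A, A = √(D.N n) := ⟨_, rfl⟩
  obtain ⟨b, hb⟩ : ∃ b, b = (D.N n : ℝ) ^ (α / 2) := ⟨_, rfl⟩
  have hQ1 : 1 ≤ Q := hQ ▸ Real.one_le_rpow hTr1 (by norm_num)
  have hA1 : 1 ≤ A := hA ▸ Real.one_le_sqrt.mpr hNr
  have hb0 : 0 < b := hb ▸ Real.rpow_pos_of_pos hN0 _
  have hQ0 : 0 < Q := by linarith
  have hA0 : 0 < A := by linarith
  have hTQ : (D.T n : ℝ) = Q ^ 4 := by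
    rw [hQ, ← Real.rpow_natCast, ← Real.rpow_mul hT0.le]; norm_num
  have hsT : √(D.T n) = Q ^ 2 := by
    rw [hTQ, show Q ^ 4 = (Q ^ 2) ^ 2 by ring, Real.sqrt_sq (by positivity)]
  have hTh : (D.T n : ℝ) ^ (-(1 / 2) : ℝ) = (Q ^ 2)⁻¹ := by
    rw [Real.rpow_neg hT0.le, ← Real.sqrt_eq_rpow, hsT]
  have hTq' : (D.T n : ℝ) ^ (-(1 / 4) : ℝ) = Q⁻¹ := by rw [Real.rpow_neg hT0.le, hQ]
  have hNA : (D.N n : ℝ) = A ^ 2 := by rw [hA, Real.sq_sqrt hN0.le]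
  have hbi : (D.N n : ℝ) ^ (-(α / 2)) = b⁻¹ := by rw [Real.rpow_neg hN0.le, hb]
  have hρ : D.sqrtRate α n = A / b ^ 2 + A ^ 2 / (b ^ 2 * Q ^ 2) := by
    have hb2 : b ^ 2 = (D.N n : ℝ) ^ α := by
      rw [hb, ← Real.rpow_natCast, ← Real.rpow_mul hN0.le]
      congr 1; push_cast; ring
    rw [sqrtRate, hsT, ← div_div, hb2, ← hNA, hA, Real.sqrt_eq_rpow, ← Real.rpow_sub hN0]
    congr 2
    rw [Real.rpow_sub hN0, Real.rpow_one]
  have hbA : b ≤ A := by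
    rw [hA, hb, Real.sqrt_eq_rpow]
    exact Real.rpow_le_rpow_of_exponent_le hNr (by linarith)
  rw [hbi] at hbL hbC
  rw [le_div_iff₀ (by positivity)] at hbL hbC hρC
  have hρ0 := sqrtRate_nonneg (D := D) (α := α) n
  -- Each summand takes half of `b Q²`: for `Q²` this is `4 C³ ≤ b`; for `A`, the bound `b ≤ A`
  -- gives `A ≤ ρ b Q²`, and `4 C³ ρ ≤ 1`.
  have hsmall : 2 * C ^ 3 * (A + Q ^ 2) ≤ b * Q ^ 2 := by
    have h1 : 4 * C ^ 3 ≤ b := by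
      rw [inv_mul_eq_div, div_le_one hb0] at hbC
      exact hbC
    have h2 : A ≤ D.sqrtRate α n * (b * Q ^ 2) := by
      have h3 : A * b ≤ A ^ 2 := by nlinarith
      have h4 : A ^ 2 / (b ^ 2 * Q ^ 2) * (b * Q ^ 2) = A ^ 2 / b := by field_simp
      rw [hρ, add_mul, h4]
      have h5 : A ≤ A ^ 2 / b := by rw [le_div_iff₀ hb0]; exact h3
      have h6 : 0 ≤ A / b ^ 2 * (b * Q ^ 2) := by positivity
      linarith
    have h3 : 4 * C ^ 3 * D.sqrtRate α n ≤ 1 := by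
      have h4 : C ^ 3 * D.sqrtRate α n ≤ C ^ 9 * D.sqrtRate α n :=
        mul_le_mul_of_nonneg_right (pow_le_pow_right₀ hC1 (by norm_num)) hρ0
      have h5 : 0 ≤ C ^ 9 * D.sqrtRate α n := by positivity
      linarith
    have h4 := mul_le_mul_of_nonneg_left h2 (by positivity : 0 ≤ 4 * C ^ 3)
    have h5 := mul_le_mul_of_nonneg_right h3 (by positivity : 0 ≤ b * Q ^ 2)
    have h6 := mul_le_mul_of_nonneg_right h1 (by positivity : 0 ≤ Q ^ 2)
    linarith
  have e0 : |supIcc (D.k0 π₀ n) (D.T n - 1) fun t =>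
      frob ((D.T n : ℝ)⁻¹ • ∑ s ∈ Finset.Icc 1 t,
        (Matrix.vecMulVec (D.z n s ω) (D.z n s ω) - Sz))| ≤
      C₀ * (D.T n : ℝ) ^ (-(1 / 2) : ℝ) := hall 0
  have e1 : |supIcc (D.k0 π₀ n) (D.T n - 1) fun t => spNorm (D.E n t ω)| ≤
      C₀ * max √(D.N n) √(D.T n) := hall 1
  have e2 : |frob (D.Binv a n * ((D.lam n ω)ᵀ * D.lam n ω) * D.Binv a n - SL)| ≤
      C₀ * (D.N n : ℝ) ^ (-(α / 2)) := hall 2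
  have e3 : |∑ s ∈ Finset.range (D.T n), vnorm (D.z n (s + 1) ω) ^ 4| ≤ C₀ * D.T n := hall 3
  have e4 : |∑ s ∈ Finset.range (D.T n), vnorm (D.noise a n (s + 1) ω) ^ 2| ≤ C₀ * D.T n :=
    hall 4
  have e5 : |Y1 n ω| ≤ C₀ * (Fintype.card (Fin k ⊕ Fin r) * (√(D.T n) * D.T n)) := hall 5
  have e6 : |Y2 n ω| ≤ C₀ * (Fintype.card (Fin r) * (√(D.T n) * D.T n)) := hall 6
  have e7 : |Y3 n ω| ≤ C₀ * (Fintype.card (Fin (D.N n)) * (√(D.T n) * D.T n)) := hall 7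
  rw [hTh, hTQ] at e0
  rw [hsT, ← hA] at e1
  rw [hbi] at e2
  rw [hTQ] at e3 e4
  rw [hsT, hTQ] at e5 e6 e7
  simp only [Fintype.card_sum, Fintype.card_fin, Nat.cast_add] at e5 e6 e7
  rw [hNA] at e7
  have hgap0 : 0 ≤ D.supGap π₀ Fh n ω := supIcc_nonneg fun t => vnorm_nonneg _
  rw [abs_of_nonneg hgap0]
  refine supIcc_le (by positivity) fun t htk htT => ?_
  have htT0 : π₀ / 2 * D.T n ≤ t := hk t htk
  have hrt : r ≤ t := by
    rw [div_le_iff₀ hπ₀] at hTr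
    have : (r : ℝ) ≤ t := by linarith
    exact_mod_cast this
  rw [← hQ, vnorm_smul, abs_of_pos hQ0]
  have htt : t - 1 ≤ D.T n - 1 := by omega
  refine gap_le (Sz := Sz) (SL := SL) (a := a) (p := π₀) (cz := cz) (cL := cL) (C₀ := C₀)
    (A := A) (b := b) hmod (hFh n t ω htk htT hrt) hrt (by omega) htT hTQ hTq' hNA hQ1 hA1 hb0
    (fun j => ?_) (fun j => ?_) hSz hcz hSL hcL hπ₀ (by rw [← hTQ]; exact htT0) hC₀ ?_ ?_
    ((le_abs_self _).trans e2) ((le_abs_self _).trans e3) ((le_abs_self _).trans e4)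
    (((hY1' n ω (t - 1) htt).trans ((le_abs_self _).trans e5)).trans (le_of_eq (by ring)))
    (((hY2' n ω (t - 1) htt).trans ((le_abs_self _).trans e6)).trans (le_of_eq (by ring)))
    (((hY3' n ω (t - 1) htt).trans ((le_abs_self _).trans e7)).trans (le_of_eq (by ring)))
    ?_ ?_ hC.ge hρ (by linarith) hsmall
  · rw [← hbi]
    exact Real.rpow_le_rpow_of_exponent_le hNr (by linarith [(ha j).1])
  · rw [hA, Real.sqrt_eq_rpow, ← Real.rpow_neg hN0.le]
    exact Real.rpow_le_rpow_of_exponent_le hNr (by linarith [(ha j).2])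
  · exact (le_supIcc (fun t => frob ((Q ^ 4)⁻¹ • ∑ s ∈ Finset.Icc 1 t,
      (vecMulVec (D.z n s ω) (D.z n s ω) - Sz))) htk htT).trans ((le_abs_self _).trans e0)
  · refine ((le_supIcc (fun t => spNorm (D.E n t ω)) htk htT).trans
      ((le_abs_self _).trans e1)).trans (mul_le_mul_of_nonneg_left ?_ (by linarith))
    exact max_le (by linarith [sq_nonneg Q]) (by linarith)
  · rw [hsT, div_le_iff₀ (by positivity)] at hTq
    linarith
  · linarith

theorem HomLoadings.hetLoadings {SL : Matrix (Fin r) (Fin r) ℝ} (hα : 0 < α)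
    (h : D.HomLoadings P α SL) : D.HetLoadings P (fun _ => α) α SL := by
  have hB : ∀ n, D.Binv (fun _ : Fin r => α) n =
      ((D.N n : ℝ) ^ (-(α / 2))) • (1 : Matrix (Fin r) (Fin r) ℝ) := fun n => by
    rw [Binv, smul_one_eq_diagonal]
  refine ⟨h.posDef, ?_, ?_⟩
  · have e : ∀ n ω, D.Binv (fun _ : Fin r => α) n * ((D.lam n ω)ᵀ * D.lam n ω) *
        D.Binv (fun _ : Fin r => α) n =
          ((D.N n : ℝ) ^ (-α)) • ((D.lam n ω)ᵀ * D.lam n ω) := fun n ω => by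
      have e1 : (D.N n : ℝ) ^ (-(α / 2)) * (D.N n : ℝ) ^ (-(α / 2)) = (D.N n : ℝ) ^ (-α) := by
        -- `N n` may be `0`; the exponents still add because their sum `-α` is nonzero.
        rw [← Real.rpow_add' (Nat.cast_nonneg _) (by linarith)]
        congr 1; ring
      rw [hB, Matrix.smul_mul, Matrix.one_mul, Matrix.mul_smul, Matrix.mul_one, smul_smul, e1]
    simp_rw [e]
    exact h.limit
  · simp_rw [hB, smul_mulVec, one_mulVec]
    exact h.moment

end Panel

end FactorForecast

/-! ### Both claims from the heterogeneous bound. -/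

theorem lemma2 {Ω : Type*} [MeasurableSpace Ω] (P : Measure Ω) [IsProbabilityMeasure P]
    {k r : ℕ} (hr : 0 < r) (D : FactorForecast.Panel Ω k r)
    (θ : Fin k → ℝ) (β0 : Fin r → ℝ) (π₀ : ℝ) (hπ₀ : 0 < π₀) (hπ₁ : π₀ < 1)
    (Sz : Matrix (Fin k ⊕ Fin r) (Fin k ⊕ Fin r) ℝ)
    (hmeas : D.IsMeasurable)
    (hmodel : D.IsModel θ β0)
    (hu : D.ForecastError P)
    (hz : D.Predictors P π₀ Sz)
    (he : D.Idiosyncratics P π₀)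
    (Fh : (n t : ℕ) → Ω → Matrix (Fin t) (Fin r) ℝ)
    (hFh : ∀ n t ω, D.k0 π₀ n ≤ t → t ≤ D.T n - 1 → r ≤ t →
      FactorForecast.IsPCFactors (D.X n t ω) (Fh n t ω)) :
    (∀ (α : ℝ) (SL : Matrix (Fin r) (Fin r) ℝ), 1 / 2 < α → α ≤ 1 →
      D.Expansion α → D.HomLoadings P α SL → D.UniformlyClose P π₀ α Fh) ∧
    (∀ (a : Fin r → ℝ) (SL : Matrix (Fin r) (Fin r) ℝ), Antitone a →
      (∀ j, 1 / 2 < a j ∧ a j ≤ 1) →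
      D.Expansion (a ⟨r - 1, Nat.sub_lt hr one_pos⟩) →
      D.HetLoadings P a (a ⟨r - 1, Nat.sub_lt hr one_pos⟩) SL →
      D.UniformlyClose P π₀ (a ⟨r - 1, Nat.sub_lt hr one_pos⟩) Fh) := by
  have key : ∀ (α : ℝ) (a : Fin r → ℝ) (SL : Matrix (Fin r) (Fin r) ℝ), 1 / 2 < α → α ≤ 1 →
      (∀ j, α ≤ a j ∧ a j ≤ 1) → D.Expansion α → D.HetLoadings P a α SL →
      D.UniformlyClose P π₀ α Fh := fun α a SL h1 h2 h3 h4 h5 =>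
    FactorForecast.Panel.uniformlyClose_of_isBigOp h4 h1 hπ₀ hπ₁.le
      (FactorForecast.Panel.isBigOp_supGap hr hπ₀ hmeas hmodel hu hz he hFh h1 h2 h3 h4 h5)
  refine ⟨fun α SL h1 h2 hD hL => key α (fun _ => α) SL h1 h2 (fun _ => ⟨le_rfl, h2⟩) hD
    (hL.hetLoadings (by linarith)), fun a SL ha h hD hL => ?_⟩
  -- The exponents decrease, so the last one, at index `r - 1`, is the weakest strength.
  refine key _ a SL (h _).1 (h _).2 (fun j => ⟨ha ?_, (h j).2⟩) hD hL
  rw [Fin.le_def]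
  exact Nat.le_sub_one_of_lt j.2
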